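/- Let $T>0$, let $\tilde{\mathcal O}\subset\mathcal O\subset(0,\pi)$ be nonempty open sets, and let $q\in L^\infty(0,\pi)\cap W^{1,\infty}(\tilde{\mathcal O})$ satisfy $q\ge C>0$ a.e. in $(0,\pi)$ for some constant $C$. Put $$Q=\begin{pmatrix}0&0\\ q&0\end{pmatrix},\qquad L=-\partial_{xx}+Q,\qquad L^*=-\partial_{xx}+Q^t,\qquad \text{with domain } \big(H^2(0,\pi)\cap H^1_0(0,\pi)\big)^2 .$$ For $k\in\mathbb N$, $k\ge1$, let $\varphi_k(x)=\sqrt{2/\pi}\,\sin(kx)$, $I_k(q)=\int_0^\pi q\,\varphi_k^2\,dx$, $$\psi_k(x)=\alpha_k\varphi_k(x)-\frac1k\int_0^x\sin(k(x-\zeta))\big(I_k(q)-q(\zeta)\big)\varphi_k(\zeta)\,d\zeta,$$ $$\alpha_k=\frac1k\int_0^\pi\!\int_0^x\sin(k(x-\zeta))\big(I_k(q)-q(\zeta)\big)\varphi_k(\zeta)\,\varphi_k(x)\,d\zeta\,dx,$$ and $\Phi^*_{1,k}=(\psi_k,\varphi_k)^t$, $\Phi^*_{2,k}=(\varphi_k,0)^t$.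 Let $\sigma\in W^{1,\infty}(0,T)$ (continuous representative) with $\sigma(T)\ne0$. Fix $k\ge 1$ such that $$a_k^L(T):=\sigma(T)\Big(1-\frac{k^2}{\sigma(T)}\int_0^Te^{-k^2(T-s)}\sigma(s)\,ds\Big)\neq0,$$ and put $$b_k^L(T):=-I_k(q)\Big(\int_0^Te^{-k^2(T-s)}\sigma(s)\,ds-k^2\int_0^T(T-s)e^{-k^2(T-s)}\sigma(s)\,ds\Big).$$ For every $\tau\in(0,T]$ let $u_2^{(\tau)}\in L^2(0,\tau;L^2(\mathcal O))$ be a null control for the datum $\Phi^*_{1,k}+\Phi^*_{2,k}$, i.e. such that the weak solution $\Psi\in C([0,\tau];L^2(0,\pi)^2)\cap L^2(0,\tau;H^1_0(0,\pi)^2)$ of $$-\partial_t\Psi+L^*\Psi=(0,1_{\mathcal O}u_2^{(\tau)})^t \text{ in }(0,\pi)\times(0,\tau),\qquad \Psi(0,t)=\Psi(\pi,t)=0,\qquad \Psi(\cdot,\tau)=\Phi^*_{1,k}+\Phi^*_{2,k},$$ satisfies $\Psi(\cdot,0)=0$. For every $\tau\in(0,T]$ let $\theta^{(\tau)}\in H^1(0,\tau;L^2(0,\pi))$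 be a solution of the Volterra equation $$\sigma(0)\,\partial_t\theta^{(\tau)}(x,t)+\int_t^\tau\big(\sigma(s-t)\,\theta^{(\tau)}(x,s)+\sigma'(s-t)\,\partial_t\theta^{(\tau)}(x,s)\big)\,ds=1_{\mathcal O}(x)\,u_2^{(\tau)}(x,t),\qquad \theta^{(\tau)}(\cdot,\tau)=0,$$ for a.e. $(x,t)\in(0,\pi)\times(0,\tau)$, extended by zero to $(\tau,T)$. Let $F=(f_1,f_2)^t\in L^2(0,\pi)^2$ and let $Y=(y_1,y_2)^t\in L^2\big(0,T;(H^2(0,\pi)\cap H^1_0(0,\pi))^2\big)\cap H^1\big(0,T;L^2(0,\pi)^2\big)$ be a solution of $$\partial_tY+LY=\sigma(t)F(x)\ \text{ in }(0,\pi)\times(0,T),\qquad Y(0,t)=Y(\pi,t)=0,\qquad Y(\cdot,0)=0.$$ Then, with $f_1^{\varphi_k}=(f_1,\varphi_k)_{L^2(0,\pi)}$, $f_1^{\psi_k}=(f_1,\psi_k)_{L^2(0,\pi)}$, $f_2^{\varphi_k}=(f_2,\varphi_k)_{L^2(0,\pi)}$, the function $s\mapsto\sigma'(T-s)\,(y_2,\theta^{(s)})_{H^1(0,T;L^2(\mathcal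 O))}$ is integrable on $(0,T)$ and $$a_k^L(T)\big(f_1^{\varphi_k}+f_1^{\psi_k}+f_2^{\varphi_k}\big)+b_k^L(T)\,f_1^{\varphi_k} =-\sigma(0)\,(y_2,\theta^{(T)})_{H^1(0,T;L^2(\mathcal O))}-\int_0^T\sigma'(T-s)\,(y_2,\theta^{(s)})_{H^1(0,T;L^2(\mathcal O))}\,ds,$$ where $(v,w)_{H^1(0,T;L^2(\mathcal O))}=\int_0^T\!\int_{\mathcal O}\big(vw+\partial_tv\,\partial_tw\big)\,dx\,dt$. -/

import Mathlib

open MeasureTheory Set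
open scoped ENNReal ContDiff

noncomputable section

namespace SourceRec

/-! ### Function spaces -/

/-- The real Hilbert space `L²(U)`, for `U ⊆ ℝ` with Lebesgue measure. -/
abbrev L2on (U : Set ℝ) : Type := Lp ℝ 2 (volume.restrict U)

/-- The spatial interval `(0, π)`. -/
abbrev Dom : Set ℝ := Ioo 0 Real.pi

/-- `η ∈ C_c^∞(U)`. -/
def IsTest (U : Set ℝ) (η : ℝ → ℝ) : Prop :=
  ContDiff ℝ ∞ η ∧ HasCompactSupport η ∧ tsupport η ⊆ U

/-- `dv` is the weak (distributional) derivative of `v` on `U`, for functions with values in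
a normed space. -/
def HasWeakDeriv {E : Type*} [NormedAddCommGroup E] [NormedSpace ℝ E]
    (U : Set ℝ) (v dv : ℝ → E) : Prop :=
  ∀ η : ℝ → ℝ, IsTest U η →
    ∫ t in U, deriv η t • v t = - ∫ t in U, η t • dv t

/-- `v ∈ W^{1,p}(U; E)`, with weak derivative `dv`. -/
structure IsW1p {E : Type*} [NormedAddCommGroup E] [NormedSpace ℝ E]
    (U : Set ℝ) (p : ℝ≥0∞) (v dv : ℝ → E) : Prop where
  memLp : MemLp v p (volume.restrict U)
  memLp_deriv : MemLp dv p (volume.restrict U)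
  weakDeriv : HasWeakDeriv U v dv

/-- `f ∈ H¹₀(0,π)`, with weak derivative `df`: `f` lies in `H¹(0,π)` and in the closure of
`C_c^∞(0,π)` for the norm of `H¹(0,π)`. -/
structure IsH10 (f df : ℝ → ℝ) : Prop where
  h1 : IsW1p Dom 2 f df
  approx : ∀ ε : ℝ≥0∞, 0 < ε → ∃ η : ℝ → ℝ, IsTest Dom η ∧
    eLpNorm (fun x => f x - η x) 2 (volume.restrict Dom) < ε ∧
    eLpNorm (fun x => df x - deriv η x) 2 (volume.restrict Dom) < ε

/-- `v ∈ L²(0,T; H¹₀(0,π))`, with spatial derivative `dv`. -/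
structure IsL2H10 (T : ℝ) (v dv : ℝ → L2on Dom) : Prop where
  memLp : MemLp v 2 (volume.restrict (Ioo 0 T))
  memLp_dx : MemLp dv 2 (volume.restrict (Ioo 0 T))
  h10 : ∀ᵐ t ∂(volume.restrict (Ioo 0 T)), IsH10 (v t) (dv t)

/-- `v ∈ L²(0,T; H²(0,π) ∩ H¹₀(0,π))`, with second spatial derivative `ddv`. -/
def IsL2H2H10 (T : ℝ) (v ddv : ℝ → L2on Dom) : Prop :=
  ∃ dv : ℝ → L2on Dom, IsL2H10 T v dv ∧
    MemLp ddv 2 (volume.restrict (Ioo 0 T)) ∧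
    ∀ᵐ t ∂(volume.restrict (Ioo 0 T)), HasWeakDeriv Dom (dv t) (ddv t)

/-- The inner product of `H¹(0,T; L²(O))`, of `v` and `w` with time derivatives `v'`, `w'`. -/
def innerH1 (T : ℝ) (O : Set ℝ) (v v' w w' : ℝ → L2on Dom) : ℝ :=
  ∫ t in Ioo 0 T, ((∫ x in O, v t x * w t x) + ∫ x in O, v' t x * w' t x)

/-- Extension by zero of a function on `(0,τ)`. -/
def zeroExt (τ : ℝ) (v : ℝ → L2on Dom) : ℝ → L2on Dom := (Ioo 0 τ).indicator v

/-! ### Spectral data -/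

/-- The normalized Dirichlet eigenfunctions of the Laplacian on `(0,π)`. -/
def phi (k : ℕ) (x : ℝ) : ℝ := Real.sqrt (2 / Real.pi) * Real.sin (k * x)

/-- `I_k(q) = ∫₀^π q φ_k²`. -/
def Ik (q : ℝ → ℝ) (k : ℕ) : ℝ := ∫ x in (0 : ℝ)..Real.pi, q x * phi k x ^ 2

/-- `∫₀^x sin(k(x-ζ)) (I_k(q) φ_k(ζ) - q(ζ) φ_k(ζ)) dζ`. -/
def sinConv (q : ℝ → ℝ) (k : ℕ) (x : ℝ) : ℝ :=
  ∫ ζ in (0 : ℝ)..x, Real.sin (k * (x - ζ)) * (Ik q k * phi k ζ - q ζ * phi k ζ)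

/-- The constant `α_k`. -/
def alphaCoeff (q : ℝ → ℝ) (k : ℕ) : ℝ :=
  1 / (k : ℝ) * ∫ x in (0 : ℝ)..Real.pi, sinConv q k x * phi k x

/-- The function `ψ_k`. -/
def psi (q : ℝ → ℝ) (k : ℕ) (x : ℝ) : ℝ :=
  alphaCoeff q k * phi k x - 1 / (k : ℝ) * sinConv q k x

/-- `Φ*_{1,k} = (ψ_k, φ_k)`. -/
def PhiStar1 (q : ℝ → ℝ) (k : ℕ) (x : ℝ) : ℝ × ℝ := (psi q k x, phi k x)

/-- `Φ*_{2,k} = (φ_k, 0)`. -/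
def PhiStar2 (k : ℕ) (x : ℝ) : ℝ × ℝ := (phi k x, 0)

/-- `a_k^L(T)`. -/
def aL (σ : ℝ → ℝ) (k : ℕ) (T : ℝ) : ℝ :=
  σ T * (1 - (k : ℝ) ^ 2 / σ T *
    ∫ s in (0 : ℝ)..T, Real.exp (-(k : ℝ) ^ 2 * (T - s)) * σ s)

/-- `b_k^L(T)`. -/
def bL (q σ : ℝ → ℝ) (k : ℕ) (T : ℝ) : ℝ :=
  - Ik q k * ((∫ s in (0 : ℝ)..T, Real.exp (-(k : ℝ) ^ 2 * (T - s)) * σ s) -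
    (k : ℝ) ^ 2 *
      ∫ s in (0 : ℝ)..T, (T - s) * Real.exp (-(k : ℝ) ^ 2 * (T - s)) * σ s)

/-! ### The systems -/

/-- `Y = (y₁, y₂)`, with time derivatives `y₁'`, `y₂'`, is a solution in
`L²(0,T; H² ∩ H¹₀) ∩ H¹(0,T; L²)` of
`∂ₜY + (-∂ₓₓ + Q)Y = σ(t)F`, `Y = 0` at `x = 0, π`, `Y(0) = 0`, where `Q = [[0,0],[q,0]]` and
`F = (f₁, f₂)`. The functions of time are the continuous representatives. -/
structure IsStateSol (q σ : ℝ → ℝ) (T : ℝ) (f₁ f₂ : L2on Dom)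
    (y₁ y₂ y₁' y₂' : ℝ → L2on Dom) : Prop where
  cont₁ : ContinuousOn y₁ (Icc 0 T)
  cont₂ : ContinuousOn y₂ (Icc 0 T)
  time₁ : IsW1p (Ioo 0 T) 2 y₁ y₁'
  time₂ : IsW1p (Ioo 0 T) 2 y₂ y₂'
  init₁ : y₁ 0 = 0
  init₂ : y₂ 0 = 0
  space_eq : ∃ ddy₁ ddy₂ : ℝ → L2on Dom,
    IsL2H2H10 T y₁ ddy₁ ∧ IsL2H2H10 T y₂ ddy₂ ∧
    ∀ᵐ t ∂(volume.restrict (Ioo 0 T)), ∀ᵐ x ∂(volume.restrict Dom),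
      y₁' t x - ddy₁ t x = σ t * f₁ x ∧
      y₂' t x - ddy₂ t x + q x * y₁ t x = σ t * f₂ x

/-- `Ψ = (p₁, p₂) ∈ C([0,τ]; L²) ∩ L²(0,τ; H¹₀)` is the weak solution of the backward system
`-∂ₜΨ + (-∂ₓₓ + Qᵗ)Ψ = (0, 1_O u)` on `(0,π) × (0,τ)`, `Ψ = 0` at `x = 0, π`, `Ψ(τ) = z`:
for `v ∈ H¹₀(0,π)`, in the weak sense on `(0,τ)`,
`d/dt (p₁,v) = (∂ₓp₁,∂ₓv) + (q p₂,v)` and `d/dt (p₂,v) = (∂ₓp₂,∂ₓv) - (u,v)_{L²(O)}`. -/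
structure IsAdjointSol (q : ℝ → ℝ) (O : Set ℝ) (τ : ℝ) (u : ℝ → L2on O) (z : ℝ → ℝ × ℝ)
    (p₁ p₂ : ℝ → L2on Dom) : Prop where
  cont₁ : ContinuousOn p₁ (Icc 0 τ)
  cont₂ : ContinuousOn p₂ (Icc 0 τ)
  final₁ : ∀ᵐ x ∂(volume.restrict Dom), p₁ τ x = (z x).1
  final₂ : ∀ᵐ x ∂(volume.restrict Dom), p₂ τ x = (z x).2
  weak_eq : ∃ dp₁ dp₂ : ℝ → L2on Dom, IsL2H10 τ p₁ dp₁ ∧ IsL2H10 τ p₂ dp₂ ∧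
    ∀ v dv : ℝ → ℝ, IsH10 v dv →
      HasWeakDeriv (Ioo 0 τ) (fun t => ∫ x in Dom, p₁ t x * v x)
        (fun t => (∫ x in Dom, dp₁ t x * dv x) + ∫ x in Dom, q x * p₂ t x * v x) ∧
      HasWeakDeriv (Ioo 0 τ) (fun t => ∫ x in Dom, p₂ t x * v x)
        (fun t => (∫ x in Dom, dp₂ t x * dv x) - ∫ x in O, u t x * v x)

/-- `u ∈ L²(0,τ; L²(O))` steers the backward system from `Ψ(τ) = z` to `Ψ(0) = 0`. -/
def IsNullControl (q : ℝ → ℝ) (O : Set ℝ) (τ : ℝ) (z : ℝ → ℝ × ℝ) (u : ℝ → L2on O) : Prop :=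
  MemLp u 2 (volume.restrict (Ioo 0 τ)) ∧
  ∃ p₁ p₂ : ℝ → L2on Dom, IsAdjointSol q O τ u z p₁ p₂ ∧ p₁ 0 = 0 ∧ p₂ 0 = 0

/-- `θ ∈ H¹(0,τ; L²(0,π))`, with time derivative `θ'`, solves the Volterra equation
`σ(0) ∂ₜθ(t) + ∫ₜ^τ (σ(s-t) θ(s) + σ'(s-t) ∂ₜθ(s)) ds = 1_O u(t)` on `(0,τ)`, `θ(τ) = 0`. -/
structure IsVolterraSol (σ σ' : ℝ → ℝ) (O : Set ℝ) (τ : ℝ) (u : ℝ → L2on O)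
    (θ θ' : ℝ → L2on Dom) : Prop where
  cont : ContinuousOn θ (Icc 0 τ)
  time : IsW1p (Ioo 0 τ) 2 θ θ'
  final : θ τ = 0
  eqn : ∀ᵐ t ∂(volume.restrict (Ioo 0 τ)), ∀ᵐ x ∂(volume.restrict Dom),
    (σ 0 • θ' t + ∫ s in t..τ, (σ (s - t) • θ s + σ' (s - t) • θ' s) : L2on Dom) x
      = O.indicator (u t) x

end SourceRec

end

/-! Let `W = (W₁, W₂)` solve the homogeneous system with `W(0) = F`. Duhamel's principle gives `Y =
σ * W`, hence `∂ₜy₂ = σ(0) W₂ + σ' * W₂`. The Volterra operator in the equation for `θ` is the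
adjoint of `w ↦ σ * w` for the `H¹(0,τ)` inner product (`integral_volterra_duality`), so `(y₂,
θ^(τ))_{H¹(0,T;L²(O))} = ∫₀^τ ∫_O W₂ u`. Pairing `W` with the controlled adjoint state, which
vanishes at time `0`, turns the right side into `-(W(τ), Φ*_{1,k} + Φ*_{2,k})`
(`innerH1_eq_pairing`).

Since `L*Φ*_{2,k} = k² Φ*_{2,k}` and `L*Φ*_{1,k} = k² Φ*_{1,k} + I_k(q) Φ*_{2,k}` (a Jordan chain),
that pairing is `P(τ) = e^{-k²τ}(c - I_k(q) τ d)`, with `c = f₁^{φ_k} + f₁^{ψ_k} + f₂^{φ_k}` and `d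
= f₁^{φ_k}` (`inner_heat_psi`). Finally `σ(0)P(T) + (σ' * P)(T)` is the derivative of `σ * P` at
`T`; putting the derivative on `P` instead gives `a_k^L(T) c + b_k^L(T) d` (`pairing_formula`).

Everything is carried out on sine modes: a weak formulation tested against `φ_j` becomes a scalar
equation for an absolutely continuous function, encoded by `IsPrim`. Multiplication by `q` and by
`1_O` is not diagonal in the sine basis, so `W₁` is needed as an `L²`-valued function (`heat`) and
the modal identities are summed with Parseval in `L²(0,τ; L²(0,π))`. Of `W₂` only the modes
(`sndMode`) are ever used. -/

noncomputable section

namespace SourceRec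

open Filter Topology


/-! ### Absolutely continuous functions as primitives -/

/-- `v` is, on `[0,τ]`, a primitive of the integrable function `dv`. -/
structure IsPrim (τ : ℝ) (v dv : ℝ → ℝ) : Prop where
  int : IntervalIntegrable dv volume 0 τ
  eq : ∀ t ∈ Icc 0 τ, v t = v 0 + ∫ s in (0 : ℝ)..t, dv s

theorem IsPrim.mono {τ t : ℝ} {v dv : ℝ → ℝ} (h : IsPrim τ v dv) (ht : t ∈ Icc 0 τ) :
    IsPrim t v dv where
  int := h.int.mono_set (by
    rw [uIcc_of_le ht.1, uIcc_of_le (ht.1.trans ht.2)]; exact Icc_subset_Icc_right ht.2)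
  eq := fun s hs => h.eq s ⟨hs.1, hs.2.trans ht.2⟩

theorem IsPrim.continuousOn {τ : ℝ} {v dv : ℝ → ℝ} (h : IsPrim τ v dv) :
    ContinuousOn v (Icc 0 τ) := by
  rcases le_or_gt 0 τ with hτ | hτ
  · have := intervalIntegral.continuousOn_primitive_interval (a := 0) (b := τ) (μ := volume)
      (f := dv) (by rw [uIcc_of_le hτ]; exact (intervalIntegrable_iff_integrableOn_Icc_of_le hτ).1 h.int)
    rw [uIcc_of_le hτ] at this
    exact (continuousOn_const.add this).congr fun t ht => h.eq t ht
  · rw [Icc_eq_empty (not_le.2 hτ)]; exact continuousOn_empty _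

theorem IsPrim.congr_deriv {τ : ℝ} (hτ : 0 ≤ τ) {v dv dw : ℝ → ℝ} (h : IsPrim τ v dv)
    (hd : ∀ᵐ t ∂(volume.restrict (Ioo 0 τ)), dv t = dw t) : IsPrim τ v dw := by
  have hd' : ∀ᵐ t ∂(volume.restrict (Ioc 0 τ)), dv t = dw t := by
    rwa [← Measure.restrict_congr_set (Ioo_ae_eq_Ioc (μ := volume) (a := 0) (b := τ))]
  refine ⟨h.int.congr_ae (by rwa [uIoc_of_le hτ]), fun t ht => ?_⟩
  rw [h.eq t ht]
  congr 1
  apply intervalIntegral.integral_congr_ae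
  rw [ae_restrict_iff' measurableSet_Ioc] at hd'
  filter_upwards [hd'] with s hs hst
  rw [uIoc_of_le ht.1] at hst
  exact hs ⟨hst.1, hst.2.trans ht.2⟩

theorem IsPrim.congr {τ : ℝ} {v w dv : ℝ → ℝ} (h : IsPrim τ v dv)
    (hw : ∀ t ∈ Icc 0 τ, v t = w t) : IsPrim τ w dv := by
  refine ⟨h.int, fun t ht => ?_⟩
  rw [← hw t ht, ← hw 0 ⟨le_rfl, ht.1.trans ht.2⟩, h.eq t ht]

theorem IsPrim.of_hasDerivAt {τ : ℝ} {v dv : ℝ → ℝ} (h : ∀ t, HasDerivAt v (dv t) t)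
    (hc : Continuous dv) : IsPrim τ v dv where
  int := hc.intervalIntegrable _ _
  eq := fun t _ => by
    rw [intervalIntegral.integral_eq_sub_of_hasDerivAt (fun s _ => h s)
      (hc.intervalIntegrable _ _)]; ring

theorem IsPrim.add {τ : ℝ} {v dv w dw : ℝ → ℝ} (hv : IsPrim τ v dv) (hw : IsPrim τ w dw) :
    IsPrim τ (fun t => v t + w t) (fun t => dv t + dw t) where
  int := hv.int.add hw.int
  eq := fun t ht => by
    rw [intervalIntegral.integral_add (hv.mono ht).int (hw.mono ht).int, hv.eq t ht, hw.eq t ht]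
    ring

theorem IsPrim.const_mul {τ : ℝ} {v dv : ℝ → ℝ} (c : ℝ) (hv : IsPrim τ v dv) :
    IsPrim τ (fun t => c * v t) (fun t => c * dv t) where
  int := hv.int.const_mul c
  eq := fun t ht => by
    rw [intervalIntegral.integral_const_mul, hv.eq t ht]
    ring

theorem IsPrim.sub {τ : ℝ} {v dv w dw : ℝ → ℝ} (hv : IsPrim τ v dv) (hw : IsPrim τ w dw) :
    IsPrim τ (fun t => v t - w t) (fun t => dv t - dw t) := by
  simpa [sub_eq_add_neg] using hv.add (hw.const_mul (-1))

theorem intervalIntegrable_mul_continuousOn {τ : ℝ} {f g : ℝ → ℝ} (hτ : 0 ≤ τ)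
    (hf : IntervalIntegrable f volume 0 τ) (hg : ContinuousOn g (Icc 0 τ)) :
    IntervalIntegrable (fun t => f t * g t) volume 0 τ :=
  hf.mul_continuousOn (by rwa [uIcc_of_le hτ])

/-- Primitives of integrable functions are absolutely continuous, and Lebesgue differentiation
identifies their derivative with the integrand almost everywhere. This integration by parts
underlies nearly every modal identity below, in space and in time. -/
theorem IsPrim.integral_mul {τ : ℝ} (hτ : 0 ≤ τ) {v dv w dw : ℝ → ℝ} (hv : IsPrim τ v dv)
    (hw : IsPrim τ w dw) :
    ∫ t in (0 : ℝ)..τ, (dv t * w t + v t * dw t) = v τ * w τ - v 0 * w 0 := by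
  have ac : ∀ {v dv : ℝ → ℝ}, IsPrim τ v dv →
      AbsolutelyContinuousOnInterval (fun t => v 0 + ∫ s in (0 : ℝ)..t, dv s) 0 τ := by
    intro v dv hv
    have h1 : AbsolutelyContinuousOnInterval (fun _ : ℝ => v 0) 0 τ :=
      ContDiffOn.absolutelyContinuousOnInterval contDiff_const.contDiffOn
    exact h1.add (hv.int.absolutelyContinuousOnInterval_intervalIntegral left_mem_uIcc)
  have key := (ac hv).integral_deriv_mul_eq_sub (ac hw)
  have hm0 : (0 : ℝ) ∈ Icc 0 τ := ⟨le_rfl, hτ⟩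
  have hmτ : τ ∈ Icc 0 τ := ⟨hτ, le_rfl⟩
  simp only [← hv.eq τ hmτ, ← hw.eq τ hmτ, ← hv.eq 0 hm0, ← hw.eq 0 hm0] at key
  rw [← key]
  apply intervalIntegral.integral_congr_ae
  filter_upwards [hv.int.ae_hasDerivAt_integral, hw.int.ae_hasDerivAt_integral] with t h1 h2 ht
  have ht' := uIoc_subset_uIcc ht
  rw [((h1 ht' 0 left_mem_uIcc).const_add (v 0)).deriv,
    ((h2 ht' 0 left_mem_uIcc).const_add (w 0)).deriv]
  rw [uIcc_of_le hτ] at ht'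
  rw [hv.eq t ht', hw.eq t ht']

/-- Uniqueness of the derivative of a primitive. -/
theorem IsPrim.ae_eq {τ : ℝ} {v dv dw : ℝ → ℝ} (hv : IsPrim τ v dv) (hw : IsPrim τ v dw) :
    ∀ᵐ t ∂(volume.restrict (Ioo 0 τ)), dv t = dw t := by
  rw [ae_restrict_iff' measurableSet_Ioo]
  filter_upwards [hv.int.ae_hasDerivAt_integral, hw.int.ae_hasDerivAt_integral] with t h1 h2 ht
  have ht' : t ∈ uIcc 0 τ := by
    rw [uIcc_of_le (ht.1.trans ht.2).le]; exact Ioo_subset_Icc_self ht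
  have e1 := h1 ht' 0 left_mem_uIcc
  have e2 := h2 ht' 0 left_mem_uIcc
  refine e1.unique (e2.congr_of_eventuallyEq ?_)
  filter_upwards [Ioo_mem_nhds ht.1 ht.2] with s hs
  have hs' := Ioo_subset_Icc_self hs
  have := hv.eq s hs'
  rw [hw.eq s hs'] at this
  linarith

/-- Integrating factor: `v(t) e^{-ct}` has zero derivative and starts from `0`. -/
theorem IsPrim.eq_zero_of_linear {τ c : ℝ} {v : ℝ → ℝ} (hv : IsPrim τ v (fun t => c * v t))
    (h0 : v 0 = 0) : ∀ t ∈ Icc 0 τ, v t = 0 := by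
  intro t ht
  have he : IsPrim τ (fun t => Real.exp (-c * t)) (fun t => -c * Real.exp (-c * t)) :=
    IsPrim.of_hasDerivAt (fun s => by
      have := ((hasDerivAt_id s).const_mul (-c)).exp
      simpa [mul_comm] using this) (by fun_prop)
  have := (hv.mono ht).integral_mul ht.1 (he.mono ht)
  have h2 : ∀ s : ℝ, c * v s * Real.exp (-c * s) + v s * (-c * Real.exp (-c * s)) = 0 :=
    fun s => by ring
  simp only [h2, h0, intervalIntegral.integral_zero, zero_mul, sub_zero] at this
  exact (mul_eq_zero.1 this.symm).resolve_right (Real.exp_pos _).ne'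

/-- Solutions of a scalar linear ODE with the same data coincide. -/
theorem IsPrim.linear_unique {τ c : ℝ} {v w g : ℝ → ℝ}
    (hv : IsPrim τ v (fun t => g t - c * v t)) (hw : IsPrim τ w (fun t => g t - c * w t))
    (h0 : v 0 = w 0) : ∀ t ∈ Icc 0 τ, v t = w t := by
  intro t ht
  have h := (hv.sub hw)
  have h' : IsPrim τ (fun t => v t - w t) (fun t => -c * (v t - w t)) :=
    ⟨h.int.congr (fun s _ => by ring), fun s hs => by
      rw [h.eq s hs]; congr 1; exact intervalIntegral.integral_congr (fun r _ => by ring)⟩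
  have := h'.eq_zero_of_linear (by simp [h0]) t ht
  linarith

/-! ### Weak derivatives on an interval -/

theorem isTest_integrable_smul {a b : ℝ} {η f : ℝ → ℝ} (hη : Continuous η)
    (hf : IntegrableOn f (Ioo a b)) : IntegrableOn (fun t => η t * f t) (Ioo a b) := by
  rcases le_or_gt b a with h | h
  · simp [Ioo_eq_empty (not_lt.2 h)]
  · have h1 : IntervalIntegrable f volume a b :=
      (intervalIntegrable_iff_integrableOn_Ioo_of_le h.le).2 hf
    exact (intervalIntegrable_iff_integrableOn_Ioo_of_le h.le).1
      (h1.continuousOn_mul hη.continuousOn)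

theorem IsTest.eq_zero {U : Set ℝ} {η : ℝ → ℝ} (h : IsTest U η) {x : ℝ} (hx : x ∉ U) : η x = 0 :=
  image_eq_zero_of_notMem_tsupport fun hx' => hx (h.2.2 hx')

theorem IsTest.isPrim {U : Set ℝ} {τ : ℝ} {η : ℝ → ℝ} (h : IsTest U η) :
    IsPrim τ η (deriv η) :=
  IsPrim.of_hasDerivAt
    (fun t => (h.1.differentiable (by simp)).differentiableAt.hasDerivAt)
    (h.1.continuous_deriv (by simp))

theorem IsTest.deriv {U : Set ℝ} {η : ℝ → ℝ} (h : IsTest U η) : IsTest U (deriv η) :=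
  ⟨(contDiff_infty_iff_deriv.1 h.1).2, h.2.1.deriv, (tsupport_deriv_subset (𝕜 := ℝ)).trans h.2.2⟩

theorem exists_isTest_integral_eq_one {τ : ℝ} (hτ : 0 < τ) :
    ∃ ρ : ℝ → ℝ, IsTest (Ioo 0 τ) ρ ∧ ∫ t in Ioo 0 τ, ρ t = 1 := by
  let b : ContDiffBump (τ / 2) := ⟨τ / 8, τ / 4, by positivity, by linarith⟩
  have hs : tsupport (b.normed volume) ⊆ Ioo 0 τ := by
    rw [b.tsupport_normed_eq, Real.closedBall_eq_Icc]
    intro x hx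
    have h1 : b.rOut = τ / 4 := rfl
    rw [h1] at hx
    exact ⟨by linarith [hx.1], by linarith [hx.2]⟩
  refine ⟨b.normed volume, ⟨b.contDiff_normed, b.hasCompactSupport_normed, hs⟩, ?_⟩
  rw [setIntegral_eq_integral_of_forall_compl_eq_zero, b.integral_normed]
  intro x hx
  exact image_eq_zero_of_notMem_tsupport fun h => hx (hs h)

/-- A test function of vanishing mean is the derivative of a test function. -/
theorem IsTest.exists_primitive {τ : ℝ} (hτ : 0 < τ) {χ : ℝ → ℝ} (h : IsTest (Ioo 0 τ) χ)
    (hm : ∫ t in Ioo 0 τ, χ t = 0) :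
    ∃ η, IsTest (Ioo 0 τ) η ∧ _root_.deriv η = χ := by
  have hc : Continuous χ := h.1.continuous
  have hd : ∀ t, HasDerivAt (fun t => ∫ s in (0 : ℝ)..t, χ s) (χ t) t := fun t =>
    intervalIntegral.integral_hasDerivAt_right (hc.intervalIntegrable _ _)
      (hc.stronglyMeasurableAtFilter _ _) hc.continuousAt
  have hder : _root_.deriv (fun t => ∫ s in (0 : ℝ)..t, χ s) = χ := funext fun t => (hd t).deriv
  -- The primitive from `0` vanishes left of `[a, b]` because `χ` does, and right of it because `χ`
  -- has mean zero. An empty support gets a degenerate interval at `τ/2`.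
  obtain ⟨a, b, hab, hsub, ha, hb⟩ : ∃ a b : ℝ, a ≤ b ∧ tsupport χ ⊆ Icc a b ∧ 0 < a ∧ b < τ := by
    rcases (tsupport χ).eq_empty_or_nonempty with he | hne
    · exact ⟨τ / 2, τ / 2, le_rfl, by simp [he], by linarith, by linarith⟩
    · have hcpt : IsCompact (tsupport χ) := h.2.1
      have h1 := h.2.2 (hcpt.sInf_mem hne)
      have h2 := h.2.2 (hcpt.sSup_mem hne)
      refine ⟨sInf (tsupport χ), sSup (tsupport χ), ?_, ?_, h1.1, h2.2⟩
      · exact csInf_le hcpt.bddBelow (hcpt.sSup_mem hne)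
      · exact fun x hx => ⟨csInf_le hcpt.bddBelow hx, le_csSup hcpt.bddAbove hx⟩
  have hz : ∀ t, t ∉ Icc a b → χ t = 0 := fun t ht =>
    image_eq_zero_of_notMem_tsupport fun h' => ht (hsub h')
  have hsupp : tsupport (fun t => ∫ s in (0 : ℝ)..t, χ s) ⊆ Icc a b := by
    refine closure_minimal (fun t ht => ?_) isClosed_Icc
    by_contra hn
    apply ht
    rw [mem_Icc, not_and_or, not_le, not_le] at hn
    rcases hn with hn | hn
    · show (∫ s in (0 : ℝ)..t, χ s) = 0
      rw [intervalIntegral.integral_congr (g := fun _ => (0 : ℝ))]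
      · simp
      · intro s hs
        apply hz
        intro h3
        have := (mem_uIcc.1 hs)
        rcases this with h4 | h4
        · linarith [h3.1]
        · linarith [h3.1]
    · show (∫ s in (0 : ℝ)..t, χ s) = 0
      have e1 : ∫ s in (0 : ℝ)..τ, χ s = 0 := by
        rw [intervalIntegral.integral_of_le hτ.le, integral_Ioc_eq_integral_Ioo, hm]
      rw [← intervalIntegral.integral_add_adjacent_intervals (hc.intervalIntegrable 0 t)
        (hc.intervalIntegrable t τ)] at e1
      have e2 : ∫ s in t..τ, χ s = 0 := by
        rw [intervalIntegral.integral_congr (g := fun _ => (0 : ℝ))]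
        · simp
        · intro s hs
          apply hz
          intro h3
          rcases mem_uIcc.1 hs with h4 | h4
          · linarith [h3.2]
          · linarith [h3.2]
      linarith
  refine ⟨fun t => ∫ s in (0 : ℝ)..t, χ s, ⟨?_, ?_, ?_⟩, hder⟩
  · rw [contDiff_infty_iff_deriv, hder]
    exact ⟨fun t => (hd t).differentiableAt, h.1⟩
  · exact HasCompactSupport.of_support_subset_isCompact isCompact_Icc
      ((subset_tsupport _).trans hsupp)
  · exact hsupp.trans (Icc_subset_Ioo ha hb)

theorem IsTest.sub_smul {U : Set ℝ} {χ ρ : ℝ → ℝ} (h : IsTest U χ) (hρ : IsTest U ρ) (c : ℝ) :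
    IsTest U (fun t => χ t - c * ρ t) := by
  refine ⟨h.1.sub (contDiff_const.mul hρ.1), h.2.1.sub (hρ.2.1.mul_left (f := fun _ => c)), ?_⟩
  refine (tsupport_sub (f := χ) (g := fun t => c * ρ t)).trans (union_subset h.2.2 ?_)
  exact (tsupport_mul_subset_right (f := fun _ => c)).trans hρ.2.2

/-- A continuous function with an integrable weak derivative is a primitive of it. -/
theorem HasWeakDeriv.isPrim {τ : ℝ} (hτ : 0 < τ) {v dv : ℝ → ℝ} (hv : ContinuousOn v (Icc 0 τ))
    (hdv : IntervalIntegrable dv volume 0 τ) (h : HasWeakDeriv (Ioo 0 τ) v dv) :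
    IsPrim τ v dv := by
  refine ⟨hdv, ?_⟩
  let V : ℝ → ℝ := fun t => ∫ s in (0 : ℝ)..t, dv s
  have hV : IsPrim τ V dv := ⟨hdv, fun t _ => by simp [V]⟩
  have hoo : ∀ f : ℝ → ℝ, ∫ t in Ioo 0 τ, f t = ∫ t in (0 : ℝ)..τ, f t := fun f => by
    rw [intervalIntegral.integral_of_le hτ.le, integral_Ioc_eq_integral_Ioo]
  have hcont : ContinuousOn (fun t => v t - V t) (Icc 0 τ) := hv.sub hV.continuousOn
  have hI : IntegrableOn (fun t => v t - V t) (Ioo 0 τ) :=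
    hcont.integrableOn_Icc.mono_set Ioo_subset_Icc_self
  have hIv : IntegrableOn v (Ioo 0 τ) := hv.integrableOn_Icc.mono_set Ioo_subset_Icc_self
  have hIV : IntegrableOn V (Ioo 0 τ) :=
    hV.continuousOn.integrableOn_Icc.mono_set Ioo_subset_Icc_self
  -- `v - V` has zero weak derivative, so du Bois-Reymond's lemma will make it constant.
  have step : ∀ η, IsTest (Ioo 0 τ) η → ∫ t in Ioo 0 τ, deriv η t * (v t - V t) = 0 := by
    intro η hη
    have h1 := h η hη
    simp only [smul_eq_mul] at h1
    have h2 := (hη.isPrim (τ := τ)).integral_mul hτ.le hV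
    rw [hη.eq_zero (x := τ) (by simp), hη.eq_zero (x := 0) (by simp), zero_mul, zero_mul, sub_zero,
      ← hoo, integral_add] at h2
    · simp only [mul_sub]
      rw [integral_sub, h1]
      · linarith
      · exact isTest_integrable_smul hη.deriv.1.continuous hIv
      · exact isTest_integrable_smul hη.deriv.1.continuous hIV
    · exact isTest_integrable_smul hη.deriv.1.continuous hIV
    · exact isTest_integrable_smul hη.1.continuous
        ((intervalIntegrable_iff_integrableOn_Ioo_of_le hτ.le).1 hdv)
  -- Subtracting from a test function its mass times `ρ` leaves mean zero, hence the derivative of a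
  -- test function. The constant is therefore the `ρ`-average of `v - V`.
  obtain ⟨ρ, hρ, hρ1⟩ := exists_isTest_integral_eq_one hτ
  set c := ∫ t in Ioo 0 τ, ρ t * (v t - V t) with hc
  have hI1 : ∀ f : ℝ → ℝ, Continuous f → IntegrableOn f (Ioo 0 τ) := fun f hf =>
    hf.continuousOn.integrableOn_Icc.mono_set Ioo_subset_Icc_self
  have hae : ∀ᵐ t : ℝ, t ∈ Ioo 0 τ → v t - V t - c = 0 := by
    refine isOpen_Ioo.ae_eq_zero_of_integral_contDiff_smul_eq_zero
      ((hI.sub (hI1 _ continuous_const)).locallyIntegrableOn) ?_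
    intro χ h1 h2 h3
    have hχ : IsTest (Ioo 0 τ) χ := ⟨h1, h2, h3⟩
    obtain ⟨η, hη, hd⟩ := (hχ.sub_smul hρ (∫ t in Ioo 0 τ, χ t)).exists_primitive hτ (by
      rw [integral_sub (hI1 _ hχ.1.continuous) ((hI1 _ hρ.1.continuous).const_mul _),
        integral_const_mul, hρ1]; ring)
    have h4 := step η hη
    rw [hd] at h4
    rw [← setIntegral_eq_integral_of_forall_compl_eq_zero (s := Ioo 0 τ)
      (fun t ht => by rw [hχ.eq_zero ht, zero_smul])]
    simp only [sub_mul, smul_eq_mul] at h4 ⊢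
    rw [integral_sub (isTest_integrable_smul hχ.1.continuous hI)] at h4
    · simp only [mul_assoc] at h4
      rw [integral_const_mul, ← hc] at h4
      simp only [mul_sub (χ _) (v _ - V _) c]
      rw [integral_sub (isTest_integrable_smul hχ.1.continuous hI), integral_mul_const]
      · exact h4
      · exact (hI1 _ hχ.1.continuous).mul_const _
    · simp only [mul_assoc]
      exact (isTest_integrable_smul hρ.1.continuous hI).const_mul _
  have hae' : ∀ᵐ t ∂(volume.restrict (Icc 0 τ)), v t - V t = c := by
    rw [Measure.restrict_congr_set (Ioo_ae_eq_Icc (μ := volume) (a := 0) (b := τ)).symm,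
      ae_restrict_iff' measurableSet_Ioo]
    filter_upwards [hae] with t ht h; linarith [ht h]
  have hall := Measure.eqOn_Icc_of_ae_eq volume hτ.ne hae' hcont continuousOn_const
  intro t ht
  have e1 := hall ht
  have e2 := hall (left_mem_Icc.2 hτ.le)
  simp only [V, intervalIntegral.integral_same] at e1 e2
  linarith


/-! ### Convolution on a half-line -/

/-- `∫₀ᵗ a(t-s) b(s) ds`. -/
def conv (a b : ℝ → ℝ) (t : ℝ) : ℝ := ∫ s in (0 : ℝ)..t, a (t - s) * b s

theorem conv_comm (a b : ℝ → ℝ) (t : ℝ) : conv a b t = conv b a t := by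
  unfold conv
  have := intervalIntegral.integral_comp_sub_left (fun s => a s * b (t - s)) (a := 0) (b := t) t
  simp only [sub_sub_cancel, sub_self, sub_zero] at this
  rw [this]
  exact intervalIntegral.integral_congr fun s _ => mul_comm _ _

@[simp] theorem conv_zero_right (a b : ℝ → ℝ) : conv a b 0 = 0 := by simp [conv]

/-- The integrand of a convolution over `(0,τ)`, tested against `c`, as a function on the plane. -/
def convKernel (τ : ℝ) (a b c : ℝ → ℝ) (p : ℝ × ℝ) : ℝ :=
  (Ioo 0 τ).indicator a (p.1 - p.2) * ((Ioo 0 τ).indicator b p.2 * (Ioo 0 τ).indicator c p.1)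

theorem integrable_indicator_of_intervalIntegrable {τ : ℝ} (hτ : 0 ≤ τ) {a : ℝ → ℝ}
    (ha : IntervalIntegrable a volume 0 τ) : Integrable ((Ioo 0 τ).indicator a) :=
  ((intervalIntegrable_iff_integrableOn_Ioo_of_le hτ).1 ha).integrable_indicator measurableSet_Ioo

theorem integrable_convKernel_one {τ : ℝ} (hτ : 0 ≤ τ) {a b : ℝ → ℝ}
    (ha : IntervalIntegrable a volume 0 τ) (hb : IntervalIntegrable b volume 0 τ) :
    Integrable (convKernel τ a b fun _ => 1) (volume.prod volume) := by
  have h1 := (integrable_indicator_of_intervalIntegrable hτ hb).convolution_integrand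
    (ContinuousLinearMap.mul ℝ ℝ) (integrable_indicator_of_intervalIntegrable hτ ha)
    (μ := volume) (ν := volume)
  have hm : Measurable fun p : ℝ × ℝ => (Ioo 0 τ).indicator (fun _ => (1 : ℝ)) p.1 :=
    (measurable_const.indicator measurableSet_Ioo).comp measurable_fst
  refine (h1.bdd_mul (c := 1) hm.aestronglyMeasurable (Filter.Eventually.of_forall fun p => ?_)).congr
    (Filter.Eventually.of_forall fun p => ?_)
  · simp only [indicator]; split_ifs <;> simp
  · simp only [convKernel, ContinuousLinearMap.mul_apply']; ring

theorem ae_bound_indicator {τ : ℝ} {a : ℝ → ℝ} (ha : MemLp a ∞ (volume.restrict (Ioo 0 τ))) :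
    AEStronglyMeasurable ((Ioo 0 τ).indicator a) volume ∧
      ∃ C, ∀ᵐ t : ℝ, ‖(Ioo 0 τ).indicator a t‖ ≤ C := by
  have h := (memLp_indicator_iff_restrict (μ := volume) (f := a) (p := ∞)
    (measurableSet_Ioo (a := (0 : ℝ)) (b := τ))).2 ha
  refine ⟨h.1, (eLpNorm ((Ioo 0 τ).indicator a) ∞ volume).toReal, ?_⟩
  have h2 := h.2
  simp only [eLpNorm_exponent_top] at h2 ⊢
  exact ae_le_eLpNormEssSup.mono fun t ht => by
    rw [← toReal_enorm]; exact ENNReal.toReal_mono h2.ne ht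

/-- The kernel is dominated by a multiple of `|b(s)| |c(t)|`. As `a` is bounded only almost
everywhere, the bound passes to `a(t - s)` because subtraction is quasi-measure-preserving. -/
theorem integrable_convKernel_of_bdd {τ : ℝ} (hτ : 0 ≤ τ) {a b c : ℝ → ℝ}
    (ha : MemLp a ∞ (volume.restrict (Ioo 0 τ))) (hb : IntervalIntegrable b volume 0 τ)
    (hc : IntervalIntegrable c volume 0 τ) :
    Integrable (convKernel τ a b c) (volume.prod volume) := by
  obtain ⟨hm, C, hC⟩ := ae_bound_indicator ha
  have hq := quasiMeasurePreserving_sub (volume : Measure ℝ) (volume : Measure ℝ)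
  have h1 := (integrable_indicator_of_intervalIntegrable hτ hc).mul_prod
    (integrable_indicator_of_intervalIntegrable hτ hb)
  refine (h1.bdd_mul (c := C) (hm.comp_quasiMeasurePreserving hq) (hq.ae hC)).congr
    (Filter.Eventually.of_forall fun p => ?_)
  simp only [convKernel, Function.comp]; ring

/-- Cutting `a` off to positive arguments enforces `s < t`. One integrand on the plane thus yields
the convolution when integrated in `s` and its transpose when integrated in `t`, and Fubini links
the two. -/
theorem integral_convKernel_left {τ : ℝ} (a b c : ℝ → ℝ) (t : ℝ) :
    ∫ s, convKernel τ a b c (t, s) = (Ioo 0 τ).indicator (fun t => conv a b t * c t) t := by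
  by_cases ht : t ∈ Ioo 0 τ
  · rw [indicator_of_mem ht, conv, intervalIntegral.integral_of_le ht.1.le,
      integral_Ioc_eq_integral_Ioo, ← integral_mul_const, ← integral_indicator measurableSet_Ioo]
    congr 1; ext s
    by_cases hs : s ∈ Ioo 0 t
    · rw [indicator_of_mem hs, convKernel, indicator_of_mem ht, indicator_of_mem, indicator_of_mem]
      · ring
      · exact ⟨hs.1, hs.2.trans ht.2⟩
      · exact ⟨by linarith [hs.2], by linarith [hs.1, ht.2]⟩
    · rw [indicator_of_notMem hs, convKernel]
      by_cases h0 : 0 < s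
      · rw [indicator_of_notMem (a := t - s), zero_mul]
        exact fun h => hs ⟨h0, by linarith [h.1]⟩
      · rw [indicator_of_notMem (a := s), zero_mul, mul_zero]
        exact fun h => h0 h.1
  · simp [convKernel, indicator_of_notMem ht]

theorem integral_convKernel_right {τ : ℝ} (a b c : ℝ → ℝ) (s : ℝ) :
    ∫ t, convKernel τ a b c (t, s) =
      (Ioo 0 τ).indicator (fun s => b s * ∫ t in s..τ, a (t - s) * c t) s := by
  by_cases hs : s ∈ Ioo 0 τ
  · rw [indicator_of_mem hs, intervalIntegral.integral_of_le hs.2.le,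
      integral_Ioc_eq_integral_Ioo, ← integral_const_mul, ← integral_indicator measurableSet_Ioo]
    congr 1; ext t
    by_cases ht : t ∈ Ioo s τ
    · rw [indicator_of_mem ht, convKernel, indicator_of_mem hs, indicator_of_mem, indicator_of_mem]
      · ring
      · exact ⟨hs.1.trans ht.1, ht.2⟩
      · exact ⟨by linarith [ht.1], by linarith [hs.1, ht.2]⟩
    · rw [indicator_of_notMem ht, convKernel]
      by_cases h0 : t < τ
      · rw [indicator_of_notMem (a := t - s), zero_mul]
        exact fun h => ht ⟨by linarith [h.1], h0⟩
      · rw [indicator_of_notMem (a := t), mul_zero, mul_zero]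
        exact fun h => h0 h.2
  · simp [convKernel, indicator_of_notMem hs]

theorem intervalIntegrable_of_integrable_indicator {τ : ℝ} (hτ : 0 ≤ τ) {f : ℝ → ℝ}
    (h : Integrable ((Ioo 0 τ).indicator f)) : IntervalIntegrable f volume 0 τ :=
  (intervalIntegrable_iff_integrableOn_Ioo_of_le hτ).2
    ((integrable_indicator_iff measurableSet_Ioo).1 h)

theorem intervalIntegrable_conv_mul {τ : ℝ} (hτ : 0 ≤ τ) {a b c : ℝ → ℝ}
    (h : Integrable (convKernel τ a b c) (volume.prod volume)) :
    IntervalIntegrable (fun t => conv a b t * c t) volume 0 τ :=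
  intervalIntegrable_of_integrable_indicator hτ (by
    simpa only [integral_convKernel_left] using h.integral_prod_left)

theorem intervalIntegrable_mul_conv_dual {τ : ℝ} (hτ : 0 ≤ τ) {a b c : ℝ → ℝ}
    (h : Integrable (convKernel τ a b c) (volume.prod volume)) :
    IntervalIntegrable (fun s => b s * ∫ t in s..τ, a (t - s) * c t) volume 0 τ :=
  intervalIntegrable_of_integrable_indicator hτ (by
    simpa only [integral_convKernel_right] using h.integral_prod_right)

theorem integral_conv_mul {τ : ℝ} (hτ : 0 ≤ τ) {a b c : ℝ → ℝ}
    (h : Integrable (convKernel τ a b c) (volume.prod volume)) :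
    ∫ t in (0 : ℝ)..τ, conv a b t * c t =
      ∫ s in (0 : ℝ)..τ, b s * ∫ t in s..τ, a (t - s) * c t := by
  have key := integral_integral_swap (f := fun t s => convKernel τ a b c (t, s)) h
  simp only [integral_convKernel_left, integral_convKernel_right] at key
  rw [integral_indicator measurableSet_Ioo, integral_indicator measurableSet_Ioo] at key
  simpa only [intervalIntegral.integral_of_le hτ, integral_Ioc_eq_integral_Ioo] using key

theorem intervalIntegrable_conv {τ : ℝ} (hτ : 0 ≤ τ) {a b : ℝ → ℝ}
    (ha : IntervalIntegrable a volume 0 τ) (hb : IntervalIntegrable b volume 0 τ) :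
    IntervalIntegrable (conv a b) volume 0 τ := by
  simpa using intervalIntegrable_conv_mul hτ (integrable_convKernel_one hτ ha hb)

/-- Differentiation of a convolution. -/
theorem IsPrim.conv {τ : ℝ} (hτ : 0 ≤ τ) {a a' b : ℝ → ℝ} (ha : IsPrim τ a a')
    (hb : IntervalIntegrable b volume 0 τ) :
    IsPrim τ (conv a b) (fun t => a 0 * b t + conv a' b t) := by
  refine ⟨(hb.const_mul _).add (intervalIntegrable_conv hτ ha.int hb), fun t ht => ?_⟩
  have hbt : IntervalIntegrable b volume 0 t := hb.mono_set (by
    rw [uIcc_of_le ht.1, uIcc_of_le hτ]; exact Icc_subset_Icc_right ht.2)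
  have hat := ha.mono ht
  rw [conv_zero_right, zero_add, intervalIntegral.integral_add (hbt.const_mul _)
    (intervalIntegrable_conv ht.1 hat.int hbt)]
  -- Fubini against the constant `1`: the integral of `a' * b` over `(0,t)` is that of `b(s) (a(t-s)
  -- - a(0))`.
  have h1 := integral_conv_mul ht.1 (integrable_convKernel_one ht.1 hat.int hbt)
  have h2 := intervalIntegrable_mul_conv_dual ht.1 (integrable_convKernel_one ht.1 hat.int hbt)
  simp only [mul_one] at h1 h2
  rw [h1, ← intervalIntegral.integral_add (hbt.const_mul _) h2, SourceRec.conv]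
  refine intervalIntegral.integral_congr fun s hs => ?_
  rw [uIcc_of_le ht.1] at hs
  have h3 : ∫ r in s..t, a' (r - s) = ∫ r in (0 : ℝ)..(t - s), a' r := by
    rw [intervalIntegral.integral_comp_sub_right a' s, sub_self]
  simp only [h3]
  rw [hat.eq (t - s) ⟨by linarith [hs.2], by linarith [hs.1]⟩]
  ring

theorem intervalIntegrable_shift_mul {E : Type*} [NormedAddCommGroup E] [NormedSpace ℝ E]
    {τ t : ℝ} {a : ℝ → ℝ} {c : ℝ → E} (ha : MemLp a ∞ (volume.restrict (Ioo 0 τ)))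
    (hc : IntegrableOn c (Ioo 0 τ)) (ht : t ∈ Ioo 0 τ) :
    IntervalIntegrable (fun s => a (s - t) • c s) volume t τ := by
  obtain ⟨hm, C, hC⟩ := ae_bound_indicator ha
  have hq := measurePreserving_sub_right (volume : Measure ℝ) t
  have h1 : IntegrableOn c (Ioo t τ) := hc.mono_set (Ioo_subset_Ioo_left ht.1.le)
  have h2 : IntegrableOn (fun s => (Ioo 0 τ).indicator a (s - t) • c s) (Ioo t τ) :=
    Integrable.bdd_smul (C := C) h1
      (hm.comp_quasiMeasurePreserving hq.quasiMeasurePreserving).restrict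
      (ae_restrict_of_ae (hq.quasiMeasurePreserving.ae hC))
  rw [intervalIntegrable_iff_integrableOn_Ioo_of_le ht.2.le]
  refine h2.congr_fun (fun s hs => ?_) measurableSet_Ioo
  simp only
  rw [indicator_of_mem]
  exact ⟨by linarith [hs.1], by linarith [hs.2, ht.1]⟩

/-- Duality between the Volterra operator and the convolution. -/
theorem integral_volterra_duality {τ : ℝ} (hτ : 0 ≤ τ) {a a' w θ θ' : ℝ → ℝ}
    (ha : MemLp a ∞ (volume.restrict (Ioo 0 τ))) (ha' : MemLp a' ∞ (volume.restrict (Ioo 0 τ)))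
    (hw : ContinuousOn w (Icc 0 τ)) (hθ : IntervalIntegrable θ volume 0 τ)
    (hθ' : IntervalIntegrable θ' volume 0 τ) :
    ∫ t in (0 : ℝ)..τ, (conv a w t * θ t + (a 0 * w t + conv a' w t) * θ' t) =
      ∫ t in (0 : ℝ)..τ,
        w t * (a 0 * θ' t + ∫ s in t..τ, (a (s - t) * θ s + a' (s - t) * θ' s)) := by
  have hwi : IntervalIntegrable w volume 0 τ := hw.intervalIntegrable_of_Icc hτ
  have k1 := integrable_convKernel_of_bdd hτ ha hwi hθ
  have k2 := integrable_convKernel_of_bdd hτ ha' hwi hθ'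
  have i0 : IntervalIntegrable (fun t => a 0 * (w t * θ' t)) volume 0 τ :=
    ((intervalIntegrable_mul_continuousOn hτ hθ' hw).congr
      (fun _ _ => mul_comm _ _)).const_mul _
  have e1 : ∀ t, conv a w t * θ t + (a 0 * w t + conv a' w t) * θ' t =
      conv a w t * θ t + (a 0 * (w t * θ' t) + conv a' w t * θ' t) := fun t => by ring
  simp only [e1]
  rw [intervalIntegral.integral_add (intervalIntegrable_conv_mul hτ k1)
    (i0.add (intervalIntegrable_conv_mul hτ k2)),
    intervalIntegral.integral_add i0 (intervalIntegrable_conv_mul hτ k2),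
    integral_conv_mul hτ k1, integral_conv_mul hτ k2]
  have d1 := intervalIntegrable_mul_conv_dual hτ k1
  have d2 := intervalIntegrable_mul_conv_dual hτ k2
  rw [← intervalIntegral.integral_add i0 d2, ← intervalIntegral.integral_add d1 (i0.add d2)]
  apply intervalIntegral.integral_congr_ae
  -- The integrability of the shifted integrands is available only on the open interval, so the
  -- endpoint is discarded.
  have hne : ∀ᵐ t : ℝ, t ≠ τ := by simp [ae_iff]
  filter_upwards [hne] with t htτ ht
  rw [uIoc_of_le hτ] at ht
  have ht' : t ∈ Ioo 0 τ := ⟨ht.1, lt_of_le_of_ne ht.2 htτ⟩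
  rw [intervalIntegral.integral_add]
  · ring
  · exact intervalIntegrable_shift_mul ha
      ((intervalIntegrable_iff_integrableOn_Ioo_of_le hτ).1 hθ) ht'
  · exact intervalIntegrable_shift_mul ha'
      ((intervalIntegrable_iff_integrableOn_Ioo_of_le hτ).1 hθ') ht'


/-! ### The Dirichlet sine basis -/

theorem setIntegral_Dom (f : ℝ → ℝ) : ∫ x in Dom, f x = ∫ x in (0 : ℝ)..Real.pi, f x := by
  rw [intervalIntegral.integral_of_le Real.pi_pos.le, integral_Ioc_eq_integral_Ioo]

theorem integrableOn_Dom_iff {f : ℝ → ℝ} :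
    IntegrableOn f Dom ↔ IntervalIntegrable f volume 0 Real.pi :=
  (intervalIntegrable_iff_integrableOn_Ioo_of_le Real.pi_pos.le).symm

theorem memLp_Dom_of_continuous {f : ℝ → ℝ} (hf : Continuous f) (p : ℝ≥0∞) :
    MemLp f p (volume.restrict Dom) := by
  obtain ⟨C, hC⟩ := isCompact_Icc.exists_bound_of_continuousOn (s := Icc 0 Real.pi) hf.continuousOn
  refine MemLp.of_bound hf.aestronglyMeasurable C ?_
  filter_upwards [ae_restrict_mem measurableSet_Ioo] with x hx
  exact hC x (Ioo_subset_Icc_self hx)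

/-- `2 sin((m+1)x) cos x = sin((m+2)x) + sin(mx)`: a factor `cos x` shifts the frequency, so the
induction on the power must carry all frequencies at once. -/
theorem integral_mul_sin_mul_cos_pow {f : ℝ → ℝ} (hf : IntegrableOn f Dom)
    (h : ∀ k : ℕ, ∫ x in Dom, f x * Real.sin (k * x) = 0) (n : ℕ) :
    ∀ k : ℕ, ∫ x in Dom, f x * (Real.sin (k * x) * Real.cos x ^ n) = 0 := by
  have hint : ∀ g : ℝ → ℝ, Continuous g → IntegrableOn (fun x => f x * g x) Dom := fun g hg => by
    simpa [mul_comm] using isTest_integrable_smul hg hf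
  induction n with
  | zero => simpa using h
  | succ n ih =>
    intro k
    cases k with
    | zero => simp
    | succ m =>
      have e : ∀ x, f x * (Real.sin ((m + 1 : ℕ) * x) * Real.cos x ^ (n + 1)) =
          2⁻¹ * (f x * (Real.sin ((m + 2 : ℕ) * x) * Real.cos x ^ n) +
            f x * (Real.sin (m * x) * Real.cos x ^ n)) := by
        intro x
        have h1 : ((m + 2 : ℕ) : ℝ) * x = (m + 1 : ℕ) * x + x := by push_cast; ring
        have h2 : (m : ℝ) * x = (m + 1 : ℕ) * x - x := by push_cast; ring
        rw [h1, h2, Real.sin_add, Real.sin_sub, pow_succ]; ring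
      simp only [e]
      rw [integral_const_mul, integral_add (hint _ (by fun_prop)) (hint _ (by fun_prop)),
        ih, ih]
      simp

/-- Completeness of the functions `sin (k x)` on `(0,π)`. -/
theorem ae_eq_zero_of_integral_mul_sin {f : ℝ → ℝ} (hf : IntegrableOn f Dom)
    (h : ∀ k : ℕ, ∫ x in Dom, f x * Real.sin (k * x) = 0) :
    ∀ᵐ x ∂(volume.restrict Dom), f x = 0 := by
  have hint : ∀ g : ℝ → ℝ, Continuous g → IntegrableOn (fun x => f x * g x) Dom := fun g hg => by
    simpa [mul_comm] using isTest_integrable_smul hg hf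
  have hpoly : ∀ p : Polynomial ℝ, ∫ x in Dom, f x * (Real.sin x * p.eval (Real.cos x)) = 0 := by
    intro p
    induction p using Polynomial.induction_on' with
    | add p r hp hr =>
      simp only [Polynomial.eval_add, mul_add]
      rw [integral_add (hint (fun x => Real.sin x * p.eval (Real.cos x)) (by fun_prop))
        (hint (fun x => Real.sin x * r.eval (Real.cos x)) (by fun_prop)), hp, hr, add_zero]
    | monomial n a =>
      have := integral_mul_sin_mul_cos_pow hf h n 1
      simp only [Nat.cast_one, one_mul] at this
      have e : ∀ x, f x * (Real.sin x * (Polynomial.monomial n a).eval (Real.cos x)) =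
          a * (f x * (Real.sin x * Real.cos x ^ n)) := fun x => by
        rw [Polynomial.eval_monomial]; ring
      simp only [e]
      rw [integral_const_mul, this, mul_zero]
  have hcont : ∀ g : ℝ → ℝ, Continuous g → ∫ x in Dom, f x * (Real.sin x * g x) = 0 := by
    intro g hg
    set M := ∫ x in Dom, |f x| with hM
    have hM0 : 0 ≤ M := integral_nonneg fun x => abs_nonneg _
    refine abs_eq_zero.1 (le_antisymm (le_of_forall_pos_le_add fun ε hε => ?_) (abs_nonneg _))
    -- On `(0,π)` every continuous `g` is a continuous function of `cos x`, so Weierstrass applies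
    -- on `[-1,1]`. The `+ 1` guards against `M = 0`.
    obtain ⟨p, hp⟩ := exists_polynomial_near_of_continuousOn (-1) 1 (g ∘ Real.arccos)
      (hg.comp Real.continuous_arccos).continuousOn (ε / (M + 1)) (by positivity)
    have hpc : Continuous fun x => p.eval (Real.cos x) := p.continuous.comp Real.continuous_cos
    have e : ∫ x in Dom, f x * (Real.sin x * g x) =
        ∫ x in Dom, f x * (Real.sin x * (g x - p.eval (Real.cos x))) := by
      simp only [mul_sub]
      rw [integral_sub (hint (fun x => Real.sin x * g x) (Real.continuous_sin.mul hg))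
        (hint (fun x => Real.sin x * p.eval (Real.cos x)) (Real.continuous_sin.mul hpc)),
        hpoly, sub_zero]
    rw [e, zero_add, ← Real.norm_eq_abs]
    calc _ ≤ ∫ x in Dom, ε / (M + 1) * |f x| := by
          refine norm_integral_le_of_norm_le (hf.abs.const_mul _) ?_
          filter_upwards [ae_restrict_mem measurableSet_Ioo] with x hx
          have h1 := hp (Real.cos x) ⟨Real.neg_one_le_cos x, Real.cos_le_one x⟩
          rw [Function.comp, Real.arccos_cos hx.1.le hx.2.le, abs_sub_comm] at h1
          rw [Real.norm_eq_abs, abs_mul, abs_mul, mul_comm]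
          have h2 := Real.abs_sin_le_one x
          have h3 : |Real.sin x| * |g x - p.eval (Real.cos x)| ≤ 1 * (ε / (M + 1)) :=
            mul_le_mul h2 h1.le (abs_nonneg _) zero_le_one
          rw [one_mul] at h3
          exact mul_le_mul_of_nonneg_right h3 (abs_nonneg _)
      _ = ε / (M + 1) * M := by rw [integral_const_mul]
      _ ≤ ε := by
          rw [div_mul_eq_mul_div, div_le_iff₀ (by positivity)]
          nlinarith
  have hae : ∀ᵐ x : ℝ, x ∈ Dom → f x * Real.sin x = 0 := by
    refine isOpen_Ioo.ae_eq_zero_of_integral_contDiff_smul_eq_zero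
      ((hint _ Real.continuous_sin).locallyIntegrableOn) ?_
    intro χ h1 h2 h3
    have hχ : IsTest Dom χ := ⟨h1, h2, h3⟩
    rw [← setIntegral_eq_integral_of_forall_compl_eq_zero (s := Dom)
      (fun t ht => by rw [hχ.eq_zero ht, zero_smul]), ← hcont χ h1.continuous]
    exact integral_congr_ae (Filter.Eventually.of_forall fun x => by simp only [smul_eq_mul]; ring)
  rw [ae_restrict_iff' measurableSet_Ioo]
  filter_upwards [hae] with x hx hx'
  exact (mul_eq_zero.1 (hx hx')).resolve_right (Real.sin_pos_of_mem_Ioo hx').ne'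

/-! ### Dirichlet eigenfunctions, their orthonormality and the Hilbert basis -/

theorem continuous_phi (k : ℕ) : Continuous (phi k) := by unfold phi; fun_prop

/-- `φ_k'`. -/
def dphi (k : ℕ) (x : ℝ) : ℝ := Real.sqrt (2 / Real.pi) * (k * Real.cos (k * x))

theorem continuous_dphi (k : ℕ) : Continuous (dphi k) := by unfold dphi; fun_prop

theorem hasDerivAt_phi (k : ℕ) (x : ℝ) : HasDerivAt (phi k) (dphi k x) x := by
  have := (((hasDerivAt_id x).const_mul (k : ℝ)).sin).const_mul (Real.sqrt (2 / Real.pi))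
  refine this.congr_deriv ?_
  simp only [dphi, id, mul_one]; ring

theorem hasDerivAt_dphi (k : ℕ) (x : ℝ) : HasDerivAt (dphi k) (-(k : ℝ) ^ 2 * phi k x) x := by
  have := ((((hasDerivAt_id x).const_mul (k : ℝ)).cos).const_mul (k : ℝ)).const_mul
    (Real.sqrt (2 / Real.pi))
  refine this.congr_deriv ?_
  simp [phi]; ring

theorem phi_zero (k : ℕ) : phi k 0 = 0 := by simp [phi]

theorem phi_pi (k : ℕ) : phi k Real.pi = 0 := by simp [phi, Real.sin_nat_mul_pi]

theorem integral_cos_int_mul {n : ℤ} (hn : n ≠ 0) :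
    ∫ x in (0 : ℝ)..Real.pi, Real.cos (n * x) = 0 := by
  have hn' : (n : ℝ) ≠ 0 := by exact_mod_cast hn
  rw [intervalIntegral.integral_comp_mul_left (fun x => Real.cos x) hn', integral_cos,
    Real.sin_int_mul_pi]
  simp

theorem integral_phi_mul_phi {i j : ℕ} (hi : 1 ≤ i) :
    ∫ x in Dom, phi i x * phi j x = if i = j then 1 else 0 := by
  have hpi := Real.pi_pos
  have hs : Real.sqrt (2 / Real.pi) * Real.sqrt (2 / Real.pi) = 2 / Real.pi :=
    Real.mul_self_sqrt (by positivity)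
  have e : ∀ x, phi i x * phi j x =
      (1 / Real.pi) * (Real.cos (((i : ℤ) - j : ℤ) * x) - Real.cos (((i : ℤ) + j : ℤ) * x)) := by
    intro x
    have h1 : (((i : ℤ) - j : ℤ) : ℝ) * x = i * x - j * x := by push_cast; ring
    have h2 : (((i : ℤ) + j : ℤ) : ℝ) * x = i * x + j * x := by push_cast; ring
    rw [h1, h2, Real.cos_sub, Real.cos_add]
    unfold phi
    calc _ = (Real.sqrt (2 / Real.pi) * Real.sqrt (2 / Real.pi)) *
          (Real.sin (i * x) * Real.sin (j * x)) := by ring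
      _ = _ := by rw [hs]; ring
  simp only [e]
  rw [setIntegral_Dom, intervalIntegral.integral_const_mul, intervalIntegral.integral_sub
    (Continuous.intervalIntegrable (by fun_prop) _ _)
    (Continuous.intervalIntegrable (by fun_prop) _ _),
    integral_cos_int_mul (n := (i : ℤ) + j) (by omega)]
  split_ifs with hij
  · subst hij; simp [hpi.ne']
  · rw [integral_cos_int_mul (by omega)]; simp

theorem inner_L2on (f g : L2on Dom) : inner ℝ f g = ∫ x in Dom, f x * g x := by
  rw [L2.inner_def]
  exact integral_congr_ae (Filter.Eventually.of_forall fun x => by simp [mul_comm])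

theorem inner_toLp_right {U : Set ℝ} (f : L2on U) {g : ℝ → ℝ} (hg : MemLp g 2 (volume.restrict U)) :
    inner ℝ f (hg.toLp g) = ∫ x in U, f x * g x := by
  rw [L2.inner_def]
  refine integral_congr_ae ?_
  filter_upwards [hg.coeFn_toLp] with x hx
  simp [hx, mul_comm]

/-- `φ_k` as an element of `L²(0,π)`. -/
def phiL (k : ℕ) : L2on Dom := (memLp_Dom_of_continuous (continuous_phi k) 2).toLp (phi k)

theorem coe_phiL (k : ℕ) : ∀ᵐ x ∂(volume.restrict Dom), phiL k x = phi k x :=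
  MemLp.coeFn_toLp _

theorem inner_phiL (f : L2on Dom) (k : ℕ) : inner ℝ f (phiL k) = ∫ x in Dom, f x * phi k x :=
  inner_toLp_right f _

/-- The shift by one drops `phi 0 = 0`, so that the basis is indexed by all of `ℕ`. -/
theorem orthonormal_phiL : Orthonormal ℝ fun j : ℕ => phiL (j + 1) := by
  rw [orthonormal_iff_ite]
  intro i j
  rw [inner_phiL]
  have : ∫ x in Dom, phiL (i + 1) x * phi (j + 1) x = ∫ x in Dom, phi (i + 1) x * phi (j + 1) x := by
    refine integral_congr_ae ?_
    filter_upwards [coe_phiL (i + 1)] with x hx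
    rw [hx]
  rw [this, integral_phi_mul_phi (by omega)]
  simp

theorem eq_zero_of_inner_phiL {f : L2on Dom} (h : ∀ j : ℕ, inner ℝ f (phiL (j + 1)) = 0) :
    f = 0 := by
  have hf : IntegrableOn f Dom := (Lp.memLp f).integrable (by norm_num)
  have hs : Real.sqrt (2 / Real.pi) ≠ 0 :=
    (Real.sqrt_pos.2 (div_pos two_pos Real.pi_pos)).ne'
  have := ae_eq_zero_of_integral_mul_sin hf (fun k => by
    cases k with
    | zero => simp
    | succ j =>
      have h1 := h j
      rw [inner_phiL] at h1
      have e : ∀ x, f x * phi (j + 1) x =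
          Real.sqrt (2 / Real.pi) * (f x * Real.sin ((j + 1 : ℕ) * x)) := fun x => by
        unfold phi; ring
      simp only [e] at h1
      rw [integral_const_mul] at h1
      exact (mul_eq_zero.1 h1).resolve_left hs)
  exact (Lp.eq_zero_iff_ae_eq_zero).2 this

theorem L2on_ext {f g : L2on Dom}
    (h : ∀ j : ℕ, inner ℝ f (phiL (j + 1)) = inner ℝ g (phiL (j + 1))) : f = g :=
  sub_eq_zero.1 (eq_zero_of_inner_phiL fun j => by rw [inner_sub_left, h j, sub_self])

/-- The Hilbert basis `(φ_k)_{k ≥ 1}` of `L²(0,π)`. -/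
def sineBasis : HilbertBasis ℕ ℝ (L2on Dom) :=
  HilbertBasis.mkOfOrthogonalEqBot orthonormal_phiL (by
    rw [Submodule.eq_bot_iff]
    intro f hf
    refine eq_zero_of_inner_phiL fun j => ?_
    rw [real_inner_comm]
    exact (Submodule.mem_orthogonal _ _).1 hf _ (Submodule.subset_span ⟨j, rfl⟩))

theorem sineBasis_apply (j : ℕ) : sineBasis j = phiL (j + 1) := by
  rw [sineBasis, HilbertBasis.coe_mkOfOrthogonalEqBot]

theorem sineBasis_repr (f : L2on Dom) (j : ℕ) : sineBasis.repr f j = inner ℝ f (phiL (j + 1)) := by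
  rw [HilbertBasis.repr_apply_apply, sineBasis_apply, real_inner_comm]

theorem hasSum_inner_phiL (f g : L2on Dom) :
    HasSum (fun j : ℕ => inner ℝ f (phiL (j + 1)) * inner ℝ g (phiL (j + 1))) (inner ℝ f g) := by
  have := sineBasis.hasSum_inner_mul_inner f g
  simp only [sineBasis_apply] at this
  simpa only [real_inner_comm g] using this


/-! ### The space `H¹₀(0,π)` -/

theorem abs_integral_mul_le {α : Type*} [MeasurableSpace α] {μ : Measure α} {f g : α → ℝ}
    (hf : MemLp f 2 μ) (hg : MemLp g 2 μ) :
    |∫ x, f x * g x ∂μ| ≤ (eLpNorm f 2 μ).toReal * (eLpNorm g 2 μ).toReal := by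
  have h := abs_real_inner_le_norm (hf.toLp f) (hg.toLp g)
  rw [Lp.norm_toLp, Lp.norm_toLp, L2.inner_def] at h
  have e : ∫ x, inner ℝ (hf.toLp f x) (hg.toLp g x) ∂μ = ∫ x, f x * g x ∂μ := by
    refine integral_congr_ae ?_
    filter_upwards [hf.coeFn_toLp, hg.coeFn_toLp] with x h1 h2
    simp [h1, h2, mul_comm]
  rwa [e] at h

theorem MemLp.integrable_mul_two {α : Type*} [MeasurableSpace α] {μ : Measure α} {f g : α → ℝ}
    (hf : MemLp f 2 μ) (hg : MemLp g 2 μ) : Integrable (fun x => f x * g x) μ :=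
  MemLp.integrable_mul hf hg

theorem IsTest.memLp {η : ℝ → ℝ} {U : Set ℝ} (h : IsTest U η) :
    MemLp η 2 (volume.restrict Dom) := memLp_Dom_of_continuous h.1.continuous 2

/-- Integration by parts against test functions extends to `H¹₀`. -/
theorem IsH10.integral_deriv_mul {f df g h : ℝ → ℝ} (hf : IsH10 f df)
    (hg : MemLp g 2 (volume.restrict Dom)) (hh : MemLp h 2 (volume.restrict Dom))
    (hw : HasWeakDeriv Dom g h) :
    ∫ x in Dom, df x * g x = - ∫ x in Dom, f x * h x := by
  set A := (eLpNorm g 2 (volume.restrict Dom)).toReal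
  set B := (eLpNorm h 2 (volume.restrict Dom)).toReal
  have hA : 0 ≤ A := ENNReal.toReal_nonneg
  have hB : 0 ≤ B := ENNReal.toReal_nonneg
  rw [← sub_eq_zero, sub_neg_eq_add]
  refine abs_eq_zero.1 (le_antisymm (le_of_forall_pos_le_add fun ε hε => ?_) (abs_nonneg _))
  -- The approximation error is at most `δ A + δ B`, which this choice keeps below `ε`.
  set δ := ε / (A + B + 1) with hδ
  have hδ0 : 0 < δ := by positivity
  obtain ⟨η, hη, h1, h2⟩ := hf.approx (ENNReal.ofReal δ) (ENNReal.ofReal_pos.2 hδ0)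
  have h3 := hw η hη
  simp only [smul_eq_mul] at h3
  have m1 : MemLp (fun x => f x - η x) 2 (volume.restrict Dom) := hf.h1.memLp.sub hη.memLp
  have m2 : MemLp (fun x => df x - deriv η x) 2 (volume.restrict Dom) :=
    hf.h1.memLp_deriv.sub hη.deriv.memLp
  have e1 := abs_integral_mul_le m1 hh
  have e2 := abs_integral_mul_le m2 hg
  have l1 := ENNReal.toReal_le_of_le_ofReal hδ0.le h1.le
  have l2 := ENNReal.toReal_le_of_le_ofReal hδ0.le h2.le
  simp only [sub_mul] at e1 e2
  rw [integral_sub (MemLp.integrable_mul_two hf.h1.memLp hh) (MemLp.integrable_mul_two hη.memLp hh)]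
    at e1
  rw [integral_sub (MemLp.integrable_mul_two hf.h1.memLp_deriv hg)
    (MemLp.integrable_mul_two hη.deriv.memLp hg)] at e2
  have f1 := e1.trans (mul_le_mul_of_nonneg_right l1 hB)
  have f2 := e2.trans (mul_le_mul_of_nonneg_right l2 hA)
  have f3 : δ * (A + B + 1) = ε := by rw [hδ]; field_simp
  have := abs_add_le ((∫ x in Dom, df x * g x) - ∫ x in Dom, deriv η x * g x)
    ((∫ x in Dom, f x * h x) - ∫ x in Dom, η x * h x)
  have e4 : (∫ x in Dom, df x * g x) - (∫ x in Dom, deriv η x * g x) +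
      ((∫ x in Dom, f x * h x) - ∫ x in Dom, η x * h x) =
      (∫ x in Dom, df x * g x) + ∫ x in Dom, f x * h x := by rw [h3]; ring
  rw [e4] at this
  nlinarith

theorem hasWeakDeriv_of_hasDerivAt {f df : ℝ → ℝ} (h : ∀ x, HasDerivAt f (df x) x)
    (hc : Continuous df) : HasWeakDeriv Dom f df := by
  intro η hη
  have hp : IsPrim Real.pi f df := IsPrim.of_hasDerivAt h hc
  have hfc : Continuous f := continuous_iff_continuousAt.2 fun x => (h x).continuousAt
  have := (hη.isPrim (τ := Real.pi)).integral_mul Real.pi_pos.le hp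
  rw [hη.eq_zero (x := Real.pi) (by simp), hη.eq_zero (x := 0) (by simp), zero_mul, zero_mul,
    sub_zero, intervalIntegral.integral_add] at this
  · simp only [smul_eq_mul, setIntegral_Dom]; linarith
  · exact (hη.deriv.1.continuous.mul hfc).intervalIntegrable _ _
  · exact (hη.1.continuous.mul hc).intervalIntegrable _ _

/-- A cutoff function, vanishing near `0` and `π`, equal to `1` far from them. -/
def cutoff (n : ℕ) (x : ℝ) : ℝ :=
  Real.smoothTransition ((n + 1) * x - 1) * Real.smoothTransition ((n + 1) * (Real.pi - x) - 1)

theorem contDiff_cutoff (n : ℕ) : ContDiff ℝ ∞ (cutoff n) := by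
  unfold cutoff
  exact (Real.smoothTransition.contDiff.comp (by fun_prop)).mul
    (Real.smoothTransition.contDiff.comp (by fun_prop))

theorem support_cutoff (n : ℕ) :
    Function.support (cutoff n) ⊆ Icc (1 / (n + 1 : ℝ)) (Real.pi - 1 / (n + 1)) := by
  have hn : (0 : ℝ) < n + 1 := by positivity
  intro x hx
  have h := mul_ne_zero_iff.1 hx
  have h1 : 0 < (n + 1 : ℝ) * x - 1 := by
    by_contra h1; exact h.1 (Real.smoothTransition.zero_of_nonpos (not_lt.1 h1))
  have h2 : 0 < (n + 1 : ℝ) * (Real.pi - x) - 1 := by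
    by_contra h1; exact h.2 (Real.smoothTransition.zero_of_nonpos (not_lt.1 h1))
  have e : (n + 1 : ℝ) * (1 / (n + 1)) = 1 := by field_simp
  constructor
  · exact le_of_mul_le_mul_left (by linarith) hn
  · have : 1 / (n + 1 : ℝ) ≤ Real.pi - x := le_of_mul_le_mul_left (by linarith) hn
    linarith

theorem isTest_mul_cutoff {f : ℝ → ℝ} (hf : ContDiff ℝ ∞ f) (n : ℕ) :
    IsTest Dom (fun x => f x * cutoff n x) := by
  have hn : (0 : ℝ) < 1 / (n + 1) := by positivity
  have hs : tsupport (fun x => f x * cutoff n x) ⊆ Icc (1 / (n + 1 : ℝ)) (Real.pi - 1 / (n + 1)) :=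
    closure_minimal ((Function.support_mul_subset_right f (cutoff n)).trans (support_cutoff n))
      isClosed_Icc
  refine ⟨hf.mul (contDiff_cutoff n), HasCompactSupport.of_support_subset_isCompact isCompact_Icc
    ((subset_tsupport _).trans hs), hs.trans (Icc_subset_Ioo hn (by linarith))⟩

/-- Equality holds near `x`, not merely at `x`, so that the derivative of the cutoff is eventually
zero there too. -/
theorem cutoff_eventually_eq_one {x : ℝ} (hx : x ∈ Dom) :
    ∀ᶠ n : ℕ in atTop, cutoff n =ᶠ[𝓝 x] fun _ => 1 := by
  obtain ⟨δ, hδ, hδx⟩ : ∃ δ > 0, δ < x ∧ δ < Real.pi - x := by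
    refine ⟨min x (Real.pi - x) / 2, ?_, ?_, ?_⟩
    · have := lt_min hx.1 (sub_pos.2 hx.2); linarith
    · have := min_le_left x (Real.pi - x); have := lt_min hx.1 (sub_pos.2 hx.2); linarith
    · have := min_le_right x (Real.pi - x); have := lt_min hx.1 (sub_pos.2 hx.2); linarith
  obtain ⟨N, hN⟩ := exists_nat_gt (2 / δ)
  filter_upwards [eventually_ge_atTop N] with n hn
  have hn' : 2 ≤ (n + 1 : ℝ) * δ := by
    have h1 : 2 / δ < n + 1 := hN.trans (by exact_mod_cast Nat.lt_succ_of_le hn)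
    rw [div_lt_iff₀ hδ] at h1; exact h1.le
  have hp : (0 : ℝ) ≤ n + 1 := by positivity
  filter_upwards [Ioo_mem_nhds hδx.1 (show x < Real.pi - δ by linarith)] with y hy
  rw [cutoff, Real.smoothTransition.one_of_one_le, Real.smoothTransition.one_of_one_le, mul_one]
  · nlinarith [mul_le_mul_of_nonneg_left (show δ ≤ Real.pi - y by linarith [hy.2]) hp]
  · nlinarith [mul_le_mul_of_nonneg_left hy.1.le hp]

theorem exists_bound_deriv_smoothTransition :
    ∃ C, 0 ≤ C ∧ ∀ x, |deriv Real.smoothTransition x| ≤ C ∧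
      (deriv Real.smoothTransition x ≠ 0 → 0 ≤ x ∧ x ≤ 1) := by
  have hc : Continuous (deriv Real.smoothTransition) :=
    (Real.smoothTransition.contDiff (n := 1)).continuous_deriv le_rfl
  obtain ⟨C, hC⟩ := isCompact_Icc.exists_bound_of_continuousOn (s := Icc (0 : ℝ) 1) hc.continuousOn
  have hz : ∀ x, x ∉ Icc (0 : ℝ) 1 → deriv Real.smoothTransition x = 0 := by
    intro x hx
    rw [mem_Icc, not_and_or, not_le, not_le] at hx
    rcases hx with hx | hx
    · have : Real.smoothTransition =ᶠ[𝓝 x] fun _ => 0 := by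
        filter_upwards [Iio_mem_nhds hx] with y hy
        exact Real.smoothTransition.zero_of_nonpos (le_of_lt hy)
      rw [this.deriv_eq]; simp
    · have : Real.smoothTransition =ᶠ[𝓝 x] fun _ => 1 := by
        filter_upwards [Ioi_mem_nhds hx] with y hy
        exact Real.smoothTransition.one_of_one_le (le_of_lt hy)
      rw [this.deriv_eq]; simp
  refine ⟨|C|, abs_nonneg _, fun x => ⟨?_, fun h => ?_⟩⟩
  · by_cases hx : x ∈ Icc (0 : ℝ) 1
    · exact (hC x hx).trans (le_abs_self _)
    · rw [hz x hx, abs_zero]; exact abs_nonneg _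
  · by_contra h'
    exact h (hz x h')

/-- The derivative is of order `n + 1`, but each of its two terms lives within `2/(n+1)` of one
endpoint, where the weight `x(π - x)` is of order `1/(n+1)`. -/
theorem exists_bound_deriv_cutoff :
    ∃ C, 0 ≤ C ∧ ∀ (n : ℕ) (x : ℝ), x ∈ Dom →
      x * (Real.pi - x) * |deriv (cutoff n) x| ≤ C := by
  obtain ⟨C, hC0, hC⟩ := exists_bound_deriv_smoothTransition
  have hpi := Real.pi_pos
  refine ⟨4 * C * Real.pi, by positivity, fun n x hx => ?_⟩
  set N : ℝ := n + 1 with hN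
  have hN0 : 0 < N := by positivity
  have hd : ∀ y, HasDerivAt Real.smoothTransition (deriv Real.smoothTransition y) y := fun y =>
    ((Real.smoothTransition.contDiff (n := 1)).differentiable (by simp)).differentiableAt.hasDerivAt
  have h1 : HasDerivAt (fun x => N * x - 1) N x := by
    simpa using ((hasDerivAt_id x).const_mul N).sub_const 1
  have h2 : HasDerivAt (fun x => N * (Real.pi - x) - 1) (-N) x := by
    simpa using (((hasDerivAt_id x).const_sub Real.pi).const_mul N).sub_const 1
  have h3 := ((hd (N * x - 1)).comp x h1).mul ((hd (N * (Real.pi - x) - 1)).comp x h2)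
  have h4 : deriv (cutoff n) x = _ := h3.deriv
  rw [h4]
  have hx1 : 0 < x := hx.1
  have hx2 : 0 < Real.pi - x := sub_pos.2 hx.2
  simp only [Function.comp]
  set A := deriv Real.smoothTransition (N * x - 1) with hA
  set B := deriv Real.smoothTransition (N * (Real.pi - x) - 1) with hB
  have b1 : x * (|A| * N) ≤ 2 * C := by
    by_cases h0 : A = 0
    · rw [h0]; simp; exact hC0
    · have h5 := ((hC _).2 h0).2
      have h6 := (hC (N * x - 1)).1
      have h7 : N * x ≤ 2 := by linarith
      calc x * (|A| * N) = (N * x) * |A| := by ring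
        _ ≤ 2 * C := mul_le_mul h7 h6 (abs_nonneg _) (by norm_num)
  have b2 : (Real.pi - x) * (|B| * N) ≤ 2 * C := by
    by_cases h0 : B = 0
    · rw [h0]; simp; exact hC0
    · have h5 := ((hC _).2 h0).2
      have h6 := (hC (N * (Real.pi - x) - 1)).1
      have h7 : N * (Real.pi - x) ≤ 2 := by linarith
      calc (Real.pi - x) * (|B| * N) = (N * (Real.pi - x)) * |B| := by ring
        _ ≤ 2 * C := mul_le_mul h7 h6 (abs_nonneg _) (by norm_num)
  set S := Real.smoothTransition (N * x - 1)
  set R := Real.smoothTransition (N * (Real.pi - x) - 1)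
  have s1 : |S| ≤ 1 := by
    rw [abs_of_nonneg (Real.smoothTransition.nonneg _)]; exact Real.smoothTransition.le_one _
  have s2 : |R| ≤ 1 := by
    rw [abs_of_nonneg (Real.smoothTransition.nonneg _)]; exact Real.smoothTransition.le_one _
  have t : |A * N * R + S * (B * -N)| ≤ |A| * N + |B| * N := by
    refine (abs_add_le _ _).trans (add_le_add ?_ ?_)
    · rw [abs_mul, abs_mul, abs_of_pos hN0]
      exact mul_le_of_le_one_right (by positivity) s2
    · rw [abs_mul, abs_mul, abs_neg, abs_of_pos hN0]
      exact mul_le_of_le_one_left (by positivity) s1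
  calc _ ≤ x * (Real.pi - x) * (|A| * N + |B| * N) := mul_le_mul_of_nonneg_left t (by positivity)
    _ = (Real.pi - x) * (x * (|A| * N)) + x * ((Real.pi - x) * (|B| * N)) := by ring
    _ ≤ Real.pi * (2 * C) + Real.pi * (2 * C) := by
        apply add_le_add
        · exact mul_le_mul (by linarith) b1 (by positivity) hpi.le
        · exact mul_le_mul (by linarith) b2 (by positivity) hpi.le
    _ = _ := by ring

/-- Dominated convergence in `L²(0,π)`. -/
theorem tendsto_eLpNorm_sub_of_bound {f : ℝ → ℝ} {g : ℕ → ℝ → ℝ} (hf : Continuous f)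
    (hg : ∀ n, Continuous (g n)) {C : ℝ} (hb : ∀ n, ∀ x ∈ Dom, |g n x| ≤ C)
    (hl : ∀ x ∈ Dom, Tendsto (fun n => g n x) atTop (𝓝 (f x))) :
    Tendsto (fun n => eLpNorm (fun x => f x - g n x) 2 (volume.restrict Dom)) atTop (𝓝 0) := by
  have hb' : ∀ x ∈ Dom, |f x| ≤ C := fun x hx =>
    le_of_tendsto (hl x hx).abs (Eventually.of_forall fun n => hb n x hx)
  have h2 : Tendsto (fun n => ∫⁻ x in Dom, ‖f x - g n x‖ₑ ^ (2 : ℝ)) atTop (𝓝 0) := by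
    have : (0 : ℝ≥0∞) = ∫⁻ x in Dom, 0 := by simp
    rw [this]
    refine tendsto_lintegral_of_dominated_convergence'
      (fun _ => (ENNReal.ofReal (2 * C)) ^ (2 : ℝ)) (fun n => ?_) (fun n => ?_) ?_ ?_
    · exact ((hf.sub (hg n)).measurable.enorm.pow_const _).aemeasurable
    · filter_upwards [ae_restrict_mem measurableSet_Ioo] with x hx
      gcongr
      rw [Real.enorm_eq_ofReal_abs]
      apply ENNReal.ofReal_le_ofReal
      have := abs_sub (f x) (g n x)
      linarith [hb n x hx, hb' x hx]
    · simp only [lintegral_const]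
      refine ENNReal.mul_ne_top (ENNReal.rpow_ne_top_of_nonneg (by norm_num) ENNReal.ofReal_ne_top) ?_
      simp
    · filter_upwards [ae_restrict_mem measurableSet_Ioo] with x hx
      have h3 : Tendsto (fun n => ‖f x - g n x‖ₑ) atTop (𝓝 0) := by
        have := ((tendsto_const_nhds (x := f x)).sub (hl x hx)).enorm
        simpa using this
      simpa using h3.ennrpow_const 2
  have h4 := h2.ennrpow_const (1 / 2)
  simp only [eLpNorm_eq_lintegral_rpow_enorm_toReal (p := 2) (by norm_num) (by norm_num),
    ENNReal.toReal_ofNat]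
  simpa using h4

/-- The products of `f` with the cutoffs converge to `f` in `H¹`. The dangerous term `f · cutoff'`
tends to zero pointwise and is uniformly bounded, since the linear decay of `f` at the endpoints
absorbs the growth of `cutoff'`; dominated convergence concludes. -/
theorem isH10_of_le {f df : ℝ → ℝ} (hfs : ContDiff ℝ ∞ f) (hd : ∀ x, HasDerivAt f (df x) x)
    {M : ℝ} (hM : ∀ x ∈ Dom, |f x| ≤ M * (x * (Real.pi - x))) : IsH10 f df := by
  have hdf : deriv f = df := funext fun x => (hd x).deriv
  have hc : Continuous df := hdf ▸ hfs.continuous_deriv (by simp)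
  obtain ⟨C, hC0, hC⟩ := exists_bound_deriv_cutoff
  obtain ⟨D, hD⟩ := isCompact_Icc.exists_bound_of_continuousOn (s := Icc 0 Real.pi) hc.continuousOn
  obtain ⟨B, hB⟩ := isCompact_Icc.exists_bound_of_continuousOn (s := Icc 0 Real.pi)
    hfs.continuous.continuousOn
  have hcut : ∀ n x, 0 ≤ cutoff n x ∧ cutoff n x ≤ 1 := fun n x =>
    ⟨mul_nonneg (Real.smoothTransition.nonneg _) (Real.smoothTransition.nonneg _),
      mul_le_one₀ (Real.smoothTransition.le_one _) (Real.smoothTransition.nonneg _)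
        (Real.smoothTransition.le_one _)⟩
  have hcd : ∀ n x, HasDerivAt (cutoff n) (deriv (cutoff n) x) x := fun n x =>
    ((contDiff_cutoff n).differentiable (by simp)).differentiableAt.hasDerivAt
  have hder : ∀ n x, deriv (fun x => f x * cutoff n x) x =
      df x * cutoff n x + f x * deriv (cutoff n) x := fun n x => ((hd x).mul (hcd n x)).deriv
  have t1 := tendsto_eLpNorm_sub_of_bound (f := f) (g := fun n x => f x * cutoff n x) (C := B)
    hfs.continuous (fun n => (isTest_mul_cutoff hfs n).1.continuous) (fun n x hx => by
      rw [abs_mul, abs_of_nonneg (hcut n x).1]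
      exact (mul_le_of_le_one_right (abs_nonneg _) (hcut n x).2).trans
        (hB x (Ioo_subset_Icc_self hx))) (fun x hx => by
      refine tendsto_const_nhds.congr' ?_
      filter_upwards [cutoff_eventually_eq_one hx] with n hn
      rw [hn.eq_of_nhds, mul_one])
  have t2 := tendsto_eLpNorm_sub_of_bound (f := df)
    (g := fun n => deriv (fun x => f x * cutoff n x)) (C := D + |M| * C)
    hc (fun n => (isTest_mul_cutoff hfs n).deriv.1.continuous) (fun n x hx => by
      rw [hder]
      refine (abs_add_le _ _).trans (add_le_add ?_ ?_)
      · rw [abs_mul, abs_of_nonneg (hcut n x).1]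
        exact (mul_le_of_le_one_right (abs_nonneg _) (hcut n x).2).trans
          (hD x (Ioo_subset_Icc_self hx))
      · rw [abs_mul]
        have hxx : 0 ≤ x * (Real.pi - x) := mul_nonneg hx.1.le (sub_pos.2 hx.2).le
        calc _ ≤ |M| * (x * (Real.pi - x)) * |deriv (cutoff n) x| :=
              mul_le_mul_of_nonneg_right ((hM x hx).trans
                (mul_le_mul_of_nonneg_right (le_abs_self _) hxx)) (abs_nonneg _)
          _ = |M| * (x * (Real.pi - x) * |deriv (cutoff n) x|) := by ring
          _ ≤ |M| * C := mul_le_mul_of_nonneg_left (hC n x hx) (abs_nonneg _)) (fun x hx => by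
      refine tendsto_const_nhds.congr' ?_
      filter_upwards [cutoff_eventually_eq_one hx] with n hn
      rw [hder, hn.eq_of_nhds, hn.deriv_eq]; simp)
  refine ⟨⟨memLp_Dom_of_continuous hfs.continuous 2, memLp_Dom_of_continuous hc 2,
    hasWeakDeriv_of_hasDerivAt hd hc⟩, fun ε hε => ?_⟩
  obtain ⟨n, hn⟩ := ((t1.eventually (gt_mem_nhds hε)).and (t2.eventually (gt_mem_nhds hε))).exists
  exact ⟨_, isTest_mul_cutoff hfs n, hn.1, hn.2⟩

theorem isH10_phi (k : ℕ) : IsH10 (phi k) (dphi k) := by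
  have hs : ContDiff ℝ ∞ (phi k) := by unfold phi; fun_prop
  have hpi := Real.pi_pos
  refine isH10_of_le hs (hasDerivAt_phi k)
    (M := Real.sqrt (2 / Real.pi) * k * (2 / Real.pi)) fun x hx => ?_
  have h1 : |Real.sin (k * x)| ≤ k * x := by
    refine (Real.abs_sin_le_abs).trans_eq (abs_of_nonneg (by have := hx.1; positivity))
  have h2 : |Real.sin (k * x)| ≤ k * (Real.pi - x) := by
    have e : |Real.sin (k * x)| = |Real.sin (k * (Real.pi - x))| := by
      rw [mul_sub, Real.sin_sub, Real.sin_nat_mul_pi, zero_mul, zero_sub, abs_neg, abs_mul,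
        show |Real.cos (k * Real.pi)| = 1 by simpa using Real.abs_cos_int_mul_pi k, one_mul]
    rw [e]
    exact (Real.abs_sin_le_abs).trans_eq
      (abs_of_nonneg (mul_nonneg (Nat.cast_nonneg _) (sub_pos.2 hx.2).le))
  have hx1 : 0 < x := hx.1
  have hx2 : 0 < Real.pi - x := sub_pos.2 hx.2
  have h3 : |Real.sin (k * x)| ≤ k * (2 / Real.pi) * (x * (Real.pi - x)) := by
    have h4 : Real.pi * |Real.sin (k * x)| ≤ k * 2 * (x * (Real.pi - x)) := by
      -- The larger of `x` and `π - x` is at least `π/2`, which turns `k min(x, π - x)` into a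
      -- multiple of the product.
      rcases le_total x (Real.pi / 2) with h | h
      · have : (k : ℝ) * x * Real.pi ≤ k * x * (2 * (Real.pi - x)) :=
          mul_le_mul_of_nonneg_left (by linarith) (by positivity)
        nlinarith
      · have : (k : ℝ) * (Real.pi - x) * Real.pi ≤ k * (Real.pi - x) * (2 * x) :=
          mul_le_mul_of_nonneg_left (by linarith) (by positivity)
        nlinarith
    calc |Real.sin (k * x)| = (Real.pi * |Real.sin (k * x)|) / Real.pi := by field_simp
      _ ≤ (k * 2 * (x * (Real.pi - x))) / Real.pi := by gcongr
      _ = _ := by ring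
  rw [phi, abs_mul, abs_of_nonneg (Real.sqrt_nonneg _), mul_assoc (Real.sqrt _), mul_assoc (Real.sqrt _)]
  exact mul_le_mul_of_nonneg_left h3 (Real.sqrt_nonneg _)

theorem IsH10.integral_deriv_mul_dphi {f df : ℝ → ℝ} (hf : IsH10 f df) (k : ℕ) :
    ∫ x in Dom, df x * dphi k x = (k : ℝ) ^ 2 * ∫ x in Dom, f x * phi k x := by
  have hc : Continuous fun x => -(k : ℝ) ^ 2 * phi k x := continuous_const.mul (continuous_phi k)
  rw [hf.integral_deriv_mul (memLp_Dom_of_continuous (continuous_dphi k) 2)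
    (memLp_Dom_of_continuous hc 2) (hasWeakDeriv_of_hasDerivAt (hasDerivAt_dphi k) hc),
    ← integral_neg, ← integral_const_mul]
  exact integral_congr_ae (Eventually.of_forall fun x => by simp only; ring)

/-- `(∂ₓₓ f, φ_k) = -k² (f, φ_k)` for `f ∈ H² ∩ H¹₀`. -/
theorem IsH10.inner_laplacian {f df ddf : L2on Dom} (hf : IsH10 f df)
    (hd : HasWeakDeriv Dom df ddf) (k : ℕ) :
    inner ℝ ddf (phiL k) = -(k : ℝ) ^ 2 * inner ℝ f (phiL k) := by
  rw [inner_phiL, inner_phiL]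
  -- Two integrations by parts, the first using that `φ_k` vanishes at the endpoints, the second
  -- that `f` does.
  have h1 := (isH10_phi k).integral_deriv_mul (Lp.memLp df) (Lp.memLp ddf) hd
  have h2 := hf.integral_deriv_mul_dphi k
  simp only [mul_comm (dphi k _), mul_comm (phi k _)] at h1
  linarith


/-! ### Multiplication operators -/

/-- Multiplication by a bounded function, as an operator on `L²(0,π)`. -/
def mulBy {m : ℝ → ℝ} (hm : MemLp m ∞ (volume.restrict Dom)) : L2on Dom →L[ℝ] L2on Dom :=
  (ContinuousLinearMap.mul ℝ ℝ).holderL (volume.restrict Dom) ∞ 2 2 (hm.toLp m)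

theorem coe_mulBy {m : ℝ → ℝ} (hm : MemLp m ∞ (volume.restrict Dom)) (f : L2on Dom) :
    ∀ᵐ x ∂(volume.restrict Dom), mulBy hm f x = m x * f x := by
  have h := (ContinuousLinearMap.mul ℝ ℝ).coeFn_holder (r := 2) (hm.toLp m) f
  filter_upwards [h, hm.coeFn_toLp] with x h1 h2
  have : mulBy hm f x = _ := h1
  rw [this, h2]; rfl

theorem inner_mulBy {m : ℝ → ℝ} (hm : MemLp m ∞ (volume.restrict Dom)) (f g : L2on Dom) :
    inner ℝ (mulBy hm f) g = ∫ x in Dom, m x * f x * g x := by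
  rw [inner_L2on]
  refine integral_congr_ae ?_
  filter_upwards [coe_mulBy hm f] with x hx
  rw [hx]

theorem inner_mulBy_comm {m : ℝ → ℝ} (hm : MemLp m ∞ (volume.restrict Dom)) (f g : L2on Dom) :
    inner ℝ (mulBy hm f) g = inner ℝ f (mulBy hm g) := by
  rw [inner_mulBy, real_inner_comm, inner_mulBy]
  exact integral_congr_ae (Eventually.of_forall fun x => by simp only; ring)

theorem memLp_indicator_one {O : Set ℝ} (hO : MeasurableSet O) :
    MemLp (O.indicator fun _ => (1 : ℝ)) ∞ (volume.restrict Dom) :=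
  MemLp.indicator hO (memLp_const 1)

theorem integral_mulBy_indicator {O : Set ℝ} (hO : MeasurableSet O) (hsub : O ⊆ Dom) {f g : ℝ → ℝ} :
    ∫ x in Dom, O.indicator (fun _ => (1 : ℝ)) x * f x * g x = ∫ x in O, f x * g x := by
  have e : ∀ x, O.indicator (fun _ => (1 : ℝ)) x * f x * g x = O.indicator (fun x => f x * g x) x := by
    intro x
    by_cases hx : x ∈ O <;> simp [hx]
  simp only [e]
  rw [integral_indicator hO, Measure.restrict_restrict hO, inter_eq_left.2 hsub]

/-! ### Functions of time with values in `L²(0,π)` -/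

/-- Parseval's identity in `L²(0,τ; L²(0,π))`. -/
theorem hasSum_integral_inner_phiL {S : Set ℝ} {v w : ℝ → L2on Dom}
    (hv : MemLp v 2 (volume.restrict S)) (hw : MemLp w 2 (volume.restrict S)) :
    HasSum (fun j : ℕ => ∫ t in S, inner ℝ (v t) (phiL (j + 1)) * inner ℝ (w t) (phiL (j + 1)))
      (∫ t in S, inner ℝ (v t) (w t)) := by
  -- Dominating series from `|ab| ≤ (a² + b²)/2`; by Parseval at fixed `t` its sum is `(‖v‖² +
  -- ‖w‖²)/2`, integrable in time.
  have hsum : ∀ t, HasSum (fun j : ℕ => 2⁻¹ * (inner ℝ (v t) (phiL (j + 1)) ^ 2 +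
      inner ℝ (w t) (phiL (j + 1)) ^ 2)) (2⁻¹ * (‖v t‖ ^ 2 + ‖w t‖ ^ 2)) := fun t => by
    have h1 := (hasSum_inner_phiL (v t) (v t)).add (hasSum_inner_phiL (w t) (w t))
    simpa only [real_inner_self_eq_norm_sq, ← sq] using h1.mul_left 2⁻¹
  refine hasSum_integral_of_dominated_convergence (fun j t =>
    2⁻¹ * (inner ℝ (v t) (phiL (j + 1)) ^ 2 + inner ℝ (w t) (phiL (j + 1)) ^ 2)) (fun j => ?_)
    (fun j => ?_) ?_ ?_ ?_
  · exact (hv.1.inner_const (𝕜 := ℝ)).mul (hw.1.inner_const (𝕜 := ℝ))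
  · refine Eventually.of_forall fun t => ?_
    rw [Real.norm_eq_abs, abs_mul]
    have := sq_nonneg (|(inner ℝ (v t) (phiL (j + 1)) : ℝ)| - |(inner ℝ (w t) (phiL (j + 1)) : ℝ)|)
    rw [sub_sq, sq_abs, sq_abs] at this
    linarith
  · exact Eventually.of_forall fun t => (hsum t).summable
  · simp only [fun t => (hsum t).tsum_eq]
    exact ((hv.integrable_norm_pow (by norm_num)).add
      (hw.integrable_norm_pow (by norm_num))).const_mul _
  · exact Eventually.of_forall fun t => hasSum_inner_phiL (v t) (w t)

theorem integrable_inner {S : Set ℝ} {v w : ℝ → L2on Dom}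
    (hv : MemLp v 2 (volume.restrict S)) (hw : MemLp w 2 (volume.restrict S)) :
    IntegrableOn (fun t => inner ℝ (v t) (w t)) S := by
  refine Integrable.mono' (((hv.integrable_norm_pow (by norm_num)).add
      (hw.integrable_norm_pow (by norm_num))).const_mul 2⁻¹) (hv.1.inner hw.1)
    (Eventually.of_forall fun t => ?_)
  have h1 := norm_inner_le_norm (𝕜 := ℝ) (v t) (w t)
  have h2 := sq_nonneg (‖v t‖ - ‖w t‖)
  simp only [Pi.add_apply]
  nlinarith

theorem intervalIntegrable_inner_const {U : Set ℝ} {τ : ℝ} (hτ : 0 ≤ τ) {v : ℝ → L2on U}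
    (hv : MemLp v 2 (volume.restrict (Ioo 0 τ))) (g : L2on U) :
    IntervalIntegrable (fun t => inner ℝ (v t) g) volume 0 τ :=
  (intervalIntegrable_iff_integrableOn_Ioo_of_le hτ).2
    ((hv.integrable (by norm_num)).inner_const g)

theorem IsTest.integrable_smul {E : Type*} [NormedAddCommGroup E] [NormedSpace ℝ E] {U S : Set ℝ}
    {η : ℝ → ℝ} (hη : IsTest U η) {v : ℝ → E} (hv : IntegrableOn v S) :
    IntegrableOn (fun t => η t • v t) S := by
  obtain ⟨C, hC⟩ := hη.2.1.exists_bound_of_continuous hη.1.continuous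
  exact Integrable.bdd_smul (C := C) hv hη.1.continuous.aestronglyMeasurable
    (Eventually.of_forall hC)

/-- Pairing the Bochner identity with a fixed vector gives a scalar weak derivative; continuity then
makes the scalar function a true primitive. -/
theorem IsW1p.isPrim_inner {τ : ℝ} (hτ : 0 < τ) {v v' : ℝ → L2on Dom}
    (h : IsW1p (Ioo 0 τ) 2 v v') (hc : ContinuousOn v (Icc 0 τ)) (g : L2on Dom) :
    IsPrim τ (fun t => inner ℝ (v t) g) (fun t => inner ℝ (v' t) g) := by
  refine HasWeakDeriv.isPrim hτ (hc.inner continuousOn_const)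
    (intervalIntegrable_inner_const hτ.le h.memLp_deriv g) fun η hη => ?_
  have h1 := congrArg (fun z => inner ℝ g z) (h.weakDeriv η hη)
  have i1 := hη.deriv.integrable_smul (h.memLp.integrable (by norm_num))
  have i2 := hη.integrable_smul (h.memLp_deriv.integrable (by norm_num))
  simp only [inner_neg_right] at h1
  rw [← integral_inner i1, ← integral_inner i2] at h1
  simpa only [inner_smul_right, real_inner_comm, smul_eq_mul] using h1

/-! ### The heat semigroup -/

/-- `e^{-k²t}`. -/
def expDecay (k : ℕ) (t : ℝ) : ℝ := Real.exp (-(k : ℝ) ^ 2 * t)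

theorem continuous_expDecay (k : ℕ) : Continuous (expDecay k) := by unfold expDecay; fun_prop

@[simp] theorem expDecay_zero (k : ℕ) : expDecay k 0 = 1 := by simp [expDecay]

theorem hasDerivAt_expDecay (k : ℕ) (t : ℝ) :
    HasDerivAt (expDecay k) (-(k : ℝ) ^ 2 * expDecay k t) t := by
  have := ((hasDerivAt_id t).const_mul (-(k : ℝ) ^ 2)).exp
  refine this.congr_deriv ?_
  simp only [expDecay, id, mul_one]; ring

theorem isPrim_expDecay (k : ℕ) (τ : ℝ) :
    IsPrim τ (expDecay k) (fun t => -(k : ℝ) ^ 2 * expDecay k t) :=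
  IsPrim.of_hasDerivAt (hasDerivAt_expDecay k) (continuous_const.mul (continuous_expDecay k))

theorem expDecay_max_mem (k : ℕ) (t : ℝ) : |expDecay k (max t 0)| ≤ 1 := by
  rw [expDecay, abs_of_pos (Real.exp_pos _), Real.exp_le_one_iff]
  have : 0 ≤ (k : ℝ) ^ 2 * max t 0 := by positivity
  linarith

/-- The coefficients of the heat flow in the sine basis. -/
def heatCoeff (f : L2on Dom) (t : ℝ) (j : ℕ) : ℝ :=
  -- Freezing negative times at `0` keeps the coefficients square summable, so the flow is defined
  -- and bounded for all real `t`.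
  expDecay (j + 1) (max t 0) * inner ℝ f (phiL (j + 1))

theorem abs_heatCoeff_le (f : L2on Dom) (t : ℝ) (j : ℕ) :
    ‖heatCoeff f t j‖ ≤ ‖(inner ℝ f (phiL (j + 1)) : ℝ)‖ := by
  rw [heatCoeff, norm_mul]
  exact mul_le_of_le_one_left (norm_nonneg _) (expDecay_max_mem _ _)

theorem summable_inner_phiL_sq (f : L2on Dom) :
    Summable fun j : ℕ => ‖(inner ℝ f (phiL (j + 1)) : ℝ)‖ ^ 2 := by
  simpa [← sq] using (hasSum_inner_phiL f f).summable

theorem memℓp_heatCoeff (f : L2on Dom) (t : ℝ) : Memℓp (heatCoeff f t) 2 := by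
  rw [memℓp_gen_iff (by norm_num)]
  simp only [ENNReal.toReal_ofNat, Real.rpow_two]
  exact (summable_inner_phiL_sq f).of_nonneg_of_le (fun _ => by positivity)
    fun j => pow_le_pow_left₀ (norm_nonneg _) (abs_heatCoeff_le f t j) 2

/-- The solution at time `t ≥ 0` of the heat equation on `(0,π)` with initial datum `f`. -/
def heat (f : L2on Dom) (t : ℝ) : L2on Dom :=
  sineBasis.repr.symm ⟨heatCoeff f t, memℓp_heatCoeff f t⟩

theorem inner_heat' (f : L2on Dom) (t : ℝ) (j : ℕ) :
    inner ℝ (heat f t) (phiL (j + 1)) = heatCoeff f t j := by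
  rw [← sineBasis_repr, heat, LinearIsometryEquiv.apply_symm_apply]

theorem inner_heat (f : L2on Dom) {t : ℝ} (ht : 0 ≤ t) {k : ℕ} (hk : 1 ≤ k) :
    inner ℝ (heat f t) (phiL k) = expDecay k t * inner ℝ f (phiL k) := by
  obtain ⟨j, rfl⟩ := Nat.exists_eq_add_of_le' hk
  rw [inner_heat', heatCoeff, max_eq_left ht]

theorem norm_heat_le (f : L2on Dom) (t : ℝ) : ‖heat f t‖ ≤ ‖f‖ := by
  have h1 := hasSum_inner_phiL (heat f t) (heat f t)
  have h2 := hasSum_inner_phiL f f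
  rw [real_inner_self_eq_norm_sq] at h1 h2
  refine le_of_sq_le_sq ?_ (norm_nonneg _)
  refine hasSum_le (fun j => ?_) h1 h2
  rw [inner_heat', ← sq, ← sq, sq_le_sq]
  exact abs_heatCoeff_le f t j

/-- A pointwise limit of continuous partial sums. With the norm bound this suffices for integration
in time; continuity of the flow is never needed. -/
theorem stronglyMeasurable_heat (f : L2on Dom) : StronglyMeasurable (heat f) := by
  refine stronglyMeasurable_of_tendsto (u := atTop)
    (f := fun (n : ℕ) t => ∑ j ∈ Finset.range n, heatCoeff f t j • phiL (j + 1)) (fun n => ?_) ?_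
  · refine Continuous.stronglyMeasurable (continuous_finsetSum _ fun j _ => ?_)
    have h : Continuous fun t => heatCoeff f t j :=
      ((continuous_expDecay _).comp (continuous_id.max continuous_const)).mul continuous_const
    exact h.smul continuous_const
  · rw [tendsto_pi_nhds]
    intro t
    have := (sineBasis.hasSum_repr_symm ⟨heatCoeff f t, memℓp_heatCoeff f t⟩).tendsto_sum_nat
    simp only [sineBasis_apply] at this
    exact this

theorem memLp_heat (f : L2on Dom) (τ : ℝ) (p : ℝ≥0∞) :
    MemLp (heat f) p (volume.restrict (Ioo 0 τ)) :=
  MemLp.of_bound (stronglyMeasurable_heat f).aestronglyMeasurable ‖f‖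
    (Eventually.of_forall (norm_heat_le f))


/-! ### The functions `ψ_k` -/

theorem conv_const_mul_left (c : ℝ) (a b : ℝ → ℝ) (t : ℝ) :
    conv (fun s => c * a s) b t = c * conv a b t := by
  unfold conv
  rw [← intervalIntegral.integral_const_mul]
  exact intervalIntegral.integral_congr fun s _ => by simp only; ring

theorem memLp_mul_phi {q : ℝ → ℝ} (hq : MemLp q ∞ (volume.restrict Dom)) (k : ℕ) :
    MemLp (fun x => q x * phi k x) 2 (volume.restrict Dom) :=
  (memLp_Dom_of_continuous (continuous_phi k) 2).mul hq

/-- `(I_k(q) - q) φ_k`. -/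
def psiSource (q : ℝ → ℝ) (k : ℕ) (x : ℝ) : ℝ := Ik q k * phi k x - q x * phi k x

theorem memLp_psiSource {q : ℝ → ℝ} (hq : MemLp q ∞ (volume.restrict Dom)) (k : ℕ) :
    MemLp (psiSource q k) 2 (volume.restrict Dom) :=
  ((memLp_Dom_of_continuous (continuous_phi k) 2).const_mul _).sub (memLp_mul_phi hq k)

theorem intervalIntegrable_psiSource {q : ℝ → ℝ} (hq : MemLp q ∞ (volume.restrict Dom)) (k : ℕ) :
    IntervalIntegrable (psiSource q k) volume 0 Real.pi :=
  integrableOn_Dom_iff.1 ((memLp_psiSource hq k).integrable (by norm_num))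

theorem sinConv_eq_conv (q : ℝ → ℝ) (k : ℕ) (x : ℝ) :
    sinConv q k x = conv (fun x => Real.sin (k * x)) (psiSource q k) x := rfl

theorem integral_psiSource_mul_phi {q : ℝ → ℝ} (hq : MemLp q ∞ (volume.restrict Dom)) {k : ℕ}
    (hk : 1 ≤ k) (i : ℕ) :
    ∫ x in Dom, psiSource q k x * phi i x =
      (if k = i then Ik q k else 0) - ∫ x in Dom, q x * phi k x * phi i x := by
  simp only [psiSource, sub_mul, mul_assoc (Ik q k)]
  rw [integral_sub, integral_const_mul, integral_phi_mul_phi hk]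
  · simp
  · exact (MemLp.integrable_mul_two (memLp_Dom_of_continuous (continuous_phi k) 2)
      (memLp_Dom_of_continuous (continuous_phi i) 2)).const_mul _
  · exact MemLp.integrable_mul_two (memLp_mul_phi hq k)
      (memLp_Dom_of_continuous (continuous_phi i) 2)

/-- Variation of constants: with `isPrim_cosConv` this says that `S = sinConv q k` solves `S'' + k²
S = k (I_k(q) - q) φ_k` with zero Cauchy data at `0`. No boundary term appears here because `sin 0 =
0`. -/
theorem isPrim_sinConv {q : ℝ → ℝ} (hq : MemLp q ∞ (volume.restrict Dom)) (k : ℕ) :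
    IsPrim Real.pi (sinConv q k) (conv (fun x => k * Real.cos (k * x)) (psiSource q k)) := by
  have h : IsPrim Real.pi (fun x => Real.sin (k * x)) (fun x => k * Real.cos (k * x)) :=
    IsPrim.of_hasDerivAt (fun x => by
      refine (((hasDerivAt_id x).const_mul (k : ℝ)).sin).congr_deriv ?_
      simp only [id, mul_one]; ring) (by fun_prop)
  have := h.conv Real.pi_pos.le (intervalIntegrable_psiSource hq k)
  simp only [mul_zero, Real.sin_zero, zero_mul, zero_add] at this
  exact this

theorem isPrim_cosConv {q : ℝ → ℝ} (hq : MemLp q ∞ (volume.restrict Dom)) (k : ℕ) :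
    IsPrim Real.pi (conv (fun x => k * Real.cos (k * x)) (psiSource q k))
      (fun x => k * psiSource q k x - (k : ℝ) ^ 2 * sinConv q k x) := by
  have h : IsPrim Real.pi (fun x => k * Real.cos (k * x)) (fun x => -(k : ℝ) ^ 2 * Real.sin (k * x)) :=
    IsPrim.of_hasDerivAt (fun x => by
      refine ((((hasDerivAt_id x).const_mul (k : ℝ)).cos).const_mul (k : ℝ)).congr_deriv ?_
      simp only [id, mul_one]; ring) (by fun_prop)
  have := h.conv Real.pi_pos.le (intervalIntegrable_psiSource hq k)
  simp only [mul_zero, Real.cos_zero, mul_one, conv_const_mul_left, ← sinConv_eq_conv] at this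
  simpa only [neg_mul, ← sub_eq_add_neg] using this

/-- Solvability condition: `sin(k(π - x)) = -cos(kπ) sin(kx)`, so the value at `π` is a multiple of
`∫ (I_k(q) - q) φ_k²`, which the choice of `I_k(q)` makes zero. Hence `ψ_k` satisfies the Dirichlet
condition at both ends. -/
theorem sinConv_pi {q : ℝ → ℝ} (hq : MemLp q ∞ (volume.restrict Dom)) {k : ℕ} (hk : 1 ≤ k) :
    sinConv q k Real.pi = 0 := by
  have h := integral_psiSource_mul_phi hq hk k
  have e2 : ∫ x in Dom, q x * phi k x * phi k x = Ik q k := by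
    rw [setIntegral_Dom, Ik]
    exact intervalIntegral.integral_congr fun x _ => by ring
  rw [if_pos rfl, e2, sub_self, setIntegral_Dom] at h
  have hs : Real.sqrt (2 / Real.pi) ≠ 0 := (Real.sqrt_pos.2 (div_pos two_pos Real.pi_pos)).ne'
  have e : sinConv q k Real.pi = ∫ x in (0 : ℝ)..Real.pi,
      (-Real.cos (k * Real.pi) / Real.sqrt (2 / Real.pi)) * (psiSource q k x * phi k x) := by
    rw [sinConv_eq_conv, conv]
    refine intervalIntegral.integral_congr fun x _ => ?_
    rw [mul_sub, Real.sin_sub, Real.sin_nat_mul_pi, phi]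
    field_simp
    ring
  rw [e, intervalIntegral.integral_const_mul, h, mul_zero]

theorem continuousOn_psi {q : ℝ → ℝ} (hq : MemLp q ∞ (volume.restrict Dom)) (k : ℕ) :
    ContinuousOn (psi q k) (Icc 0 Real.pi) :=
  (continuous_const.mul (continuous_phi k)).continuousOn.sub
    (continuousOn_const.mul (isPrim_sinConv hq k).continuousOn)

theorem memLp_Dom_of_continuousOn {f : ℝ → ℝ} (hf : ContinuousOn f (Icc 0 Real.pi)) (p : ℝ≥0∞) :
    MemLp f p (volume.restrict Dom) := by
  obtain ⟨C, hC⟩ := isCompact_Icc.exists_bound_of_continuousOn hf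
  refine MemLp.of_bound ((hf.mono Ioo_subset_Icc_self).aestronglyMeasurable measurableSet_Ioo) C ?_
  filter_upwards [ae_restrict_mem measurableSet_Ioo] with x hx
  exact hC x (Ioo_subset_Icc_self hx)

/-- The modes of `ψ_k`: `-ψ_k'' + q φ_k = k² ψ_k + I_k(q) φ_k`, tested against `φ_i`. -/
theorem integral_psi_mul_phi {q : ℝ → ℝ} (hq : MemLp q ∞ (volume.restrict Dom)) {k : ℕ}
    (hk : 1 ≤ k) (i : ℕ) :
    ((i : ℝ) ^ 2 - (k : ℝ) ^ 2) * ∫ x in Dom, psi q k x * phi i x =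
      (if k = i then Ik q k else 0) - ∫ x in Dom, q x * phi k x * phi i x := by
  have hk0 : (k : ℝ) ≠ 0 := by exact_mod_cast (by omega : k ≠ 0)
  have hpi := Real.pi_pos.le
  have hφ : IsPrim Real.pi (phi i) (dphi i) :=
    IsPrim.of_hasDerivAt (hasDerivAt_phi i) (continuous_dphi i)
  have hdφ : IsPrim Real.pi (dphi i) (fun x => -(i : ℝ) ^ 2 * phi i x) :=
    IsPrim.of_hasDerivAt (hasDerivAt_dphi i) (continuous_const.mul (continuous_phi i))
  have hS := isPrim_sinConv hq k
  -- Green's identity in two steps: `h1` integrates `S'' φ_i` by parts, `h2` integrates `S' φ_i'`;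
  -- all boundary terms vanish.
  have h1 := (isPrim_cosConv hq k).integral_mul hpi hφ
  have h2 := hS.integral_mul hpi hdφ
  rw [phi_pi, phi_zero, mul_zero, mul_zero, sub_zero] at h1
  rw [sinConv_pi hq hk, sinConv_eq_conv q k 0, conv_zero_right, zero_mul, zero_mul, sub_zero] at h2
  have ig : IntervalIntegrable (fun x => psiSource q k x * phi i x) volume 0 Real.pi :=
    intervalIntegrable_mul_continuousOn hpi (intervalIntegrable_psiSource hq k)
      (continuous_phi i).continuousOn
  have iS : IntervalIntegrable (fun x => sinConv q k x * phi i x) volume 0 Real.pi :=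
    intervalIntegrable_mul_continuousOn hpi (hS.continuousOn.intervalIntegrable_of_Icc hpi)
      (continuous_phi i).continuousOn
  have i1 : IntervalIntegrable (fun x => conv (fun x => k * Real.cos (k * x)) (psiSource q k) x *
      dphi i x) volume 0 Real.pi :=
    intervalIntegrable_mul_continuousOn hpi hS.int (continuous_dphi i).continuousOn
  have e1 : ∀ x, (k * psiSource q k x - (k : ℝ) ^ 2 * sinConv q k x) * phi i x +
      conv (fun x => k * Real.cos (k * x)) (psiSource q k) x * dphi i x =
      k * (psiSource q k x * phi i x) - (k : ℝ) ^ 2 * (sinConv q k x * phi i x) +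
      conv (fun x => k * Real.cos (k * x)) (psiSource q k) x * dphi i x := fun x => by ring
  have e2 : ∀ x, conv (fun x => k * Real.cos (k * x)) (psiSource q k) x * dphi i x +
      sinConv q k x * (-(i : ℝ) ^ 2 * phi i x) =
      conv (fun x => k * Real.cos (k * x)) (psiSource q k) x * dphi i x -
      (i : ℝ) ^ 2 * (sinConv q k x * phi i x) := fun x => by ring
  simp only [e1] at h1
  simp only [e2] at h2
  rw [intervalIntegral.integral_add ((ig.const_mul _).sub (iS.const_mul _)) i1,
    intervalIntegral.integral_sub (ig.const_mul _) (iS.const_mul _),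
    intervalIntegral.integral_const_mul, intervalIntegral.integral_const_mul] at h1
  rw [intervalIntegral.integral_sub i1 (iS.const_mul _), intervalIntegral.integral_const_mul] at h2
  have h3 := integral_psiSource_mul_phi hq hk i
  rw [← h3]
  have e3 : ∀ x, psi q k x * phi i x =
      alphaCoeff q k * (phi k x * phi i x) - 1 / (k : ℝ) * (sinConv q k x * phi i x) := fun x => by
    unfold psi; ring
  simp only [e3]
  have iφ : IntegrableOn (fun x => phi k x * phi i x) Dom :=
    MemLp.integrable_mul_two (memLp_Dom_of_continuous (continuous_phi k) 2)
      (memLp_Dom_of_continuous (continuous_phi i) 2)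
  rw [integral_sub (iφ.const_mul _) ((integrableOn_Dom_iff.2 iS).const_mul _), integral_const_mul,
    integral_const_mul, integral_phi_mul_phi hk, setIntegral_Dom, setIntegral_Dom]
  set G := ∫ x in (0 : ℝ)..Real.pi, psiSource q k x * phi i x
  set S := ∫ x in (0 : ℝ)..Real.pi, sinConv q k x * phi i x
  have h4 : ((i : ℝ) ^ 2 - (k : ℝ) ^ 2) * S = -(k * G) := by linarith
  have h5 : ((i : ℝ) ^ 2 - (k : ℝ) ^ 2) * (1 / (k : ℝ) * S) = -G := by
    rw [mul_left_comm, h4]; field_simp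
  rw [mul_sub, h5]
  -- The `α_k` term survives only for `i = k`, where the factor `i² - k²` kills it: the value of
  -- `α_k` plays no role.
  split_ifs with hki
  · subst hki; ring
  · ring


/-! ### Modes of the state -/

theorem IntervalIntegrable.reflect {t : ℝ} {f : ℝ → ℝ} (h : IntervalIntegrable f volume 0 t) :
    IntervalIntegrable (fun s => f (t - s)) volume 0 t := by
  simpa using (h.comp_sub_left t).symm

theorem intervalIntegrable_conv_integrand {t : ℝ} (ht : 0 ≤ t) {a b : ℝ → ℝ}
    (ha : IntervalIntegrable a volume 0 t) (hb : ContinuousOn b (Icc 0 t)) :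
    IntervalIntegrable (fun s => a (t - s) * b s) volume 0 t :=
  intervalIntegrable_mul_continuousOn ht (IntervalIntegrable.reflect ha) hb

theorem conv_linear_left {t c : ℝ} (ht : 0 ≤ t) {r w b : ℝ → ℝ}
    (hr : IntervalIntegrable r volume 0 t) (hw : IntervalIntegrable w volume 0 t)
    (hb : ContinuousOn b (Icc 0 t)) :
    conv (fun s => -r s - c * w s) b t = -conv r b t - c * conv w b t := by
  have i1 := intervalIntegrable_conv_integrand ht hr hb
  have i2 := intervalIntegrable_conv_integrand ht hw hb
  unfold conv
  rw [← intervalIntegral.integral_const_mul, ← intervalIntegral.integral_neg,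
    ← intervalIntegral.integral_sub
      (show IntervalIntegrable (fun s => -(r (t - s) * b s)) volume 0 t from i1.neg) (i2.const_mul c)]
  exact intervalIntegral.integral_congr fun s _ => by simp only; ring

/-- Duhamel's formula for scalar linear equations. -/
theorem conv_eq_of_ode {τ c : ℝ} (hτ : 0 ≤ τ) {w r σ y : ℝ → ℝ}
    (hw : IsPrim τ w (fun t => -r t - c * w t)) (hr : IntervalIntegrable r volume 0 τ)
    (hσ : ContinuousOn σ (Icc 0 τ))
    (hy : IsPrim τ y (fun t => (w 0 * σ t - conv r σ t) - c * y t)) (hy0 : y 0 = 0) :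
    ∀ t ∈ Icc 0 τ, y t = conv w σ t := by
  have hwi : IntervalIntegrable w volume 0 τ := hw.continuousOn.intervalIntegrable_of_Icc hτ
  -- Substituting `w' = -r - c w` in `(w * σ)' = w(0) σ + w' * σ` shows that `w * σ` solves the same
  -- linear equation as `y`.
  have h := (hw.conv hτ (hσ.intervalIntegrable_of_Icc hτ)).congr_deriv hτ
    (dw := fun t => (w 0 * σ t - conv r σ t) - c * conv w σ t) (by
      filter_upwards [ae_restrict_mem measurableSet_Ioo] with t ht
      have hsub : uIcc 0 t ⊆ uIcc 0 τ := by
        rw [uIcc_of_le ht.1.le, uIcc_of_le hτ]; exact Icc_subset_Icc_right ht.2.le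
      rw [conv_linear_left ht.1.le (hr.mono_set hsub) (hwi.mono_set hsub)
        (hσ.mono (Icc_subset_Icc_right ht.2.le))]
      ring)
  exact hy.linear_unique h (by rw [hy0, conv_zero_right])

theorem L2on_eq_of_ae {U : Set ℝ} {f g : L2on U} (h : ∀ᵐ x ∂(volume.restrict U), f x = g x) : f = g :=
  Lp.ext h

section State

variable {q σ : ℝ → ℝ} {T : ℝ} {f₁ f₂ : L2on Dom} {y₁ y₂ y₁' y₂' : ℝ → L2on Dom}

theorem IsStateSol.isPrim_fst (hY : IsStateSol q σ T f₁ f₂ y₁ y₂ y₁' y₂') (hT : 0 < T) (k : ℕ) :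
    IsPrim T (fun t => inner ℝ (y₁ t) (phiL k))
      (fun t => inner ℝ f₁ (phiL k) * σ t - (k : ℝ) ^ 2 * inner ℝ (y₁ t) (phiL k)) := by
  refine (hY.time₁.isPrim_inner hT hY.cont₁ (phiL k)).congr_deriv hT.le ?_
  obtain ⟨ddy₁, ddy₂, ⟨dy₁, hd, -, hdd⟩, -, heq⟩ := hY.space_eq
  filter_upwards [hd.h10, hdd, heq] with t h1 h2 h3
  have e : y₁' t = ddy₁ t + σ t • f₁ := by
    refine L2on_eq_of_ae ?_
    filter_upwards [h3, Lp.coeFn_add (ddy₁ t) (σ t • f₁), Lp.coeFn_smul (σ t) f₁] with x a1 a2 a3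
    rw [a2, Pi.add_apply, a3, Pi.smul_apply, smul_eq_mul, ← a1.1]; ring
  rw [e, inner_add_left, h1.inner_laplacian h2, real_inner_smul_left]; ring

theorem IsStateSol.isPrim_snd (hY : IsStateSol q σ T f₁ f₂ y₁ y₂ y₁' y₂') (hT : 0 < T)
    (hq : MemLp q ∞ (volume.restrict Dom)) (k : ℕ) :
    IsPrim T (fun t => inner ℝ (y₂ t) (phiL k))
      (fun t => (inner ℝ f₂ (phiL k) * σ t - inner ℝ (y₁ t) (mulBy hq (phiL k))) -
        (k : ℝ) ^ 2 * inner ℝ (y₂ t) (phiL k)) := by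
  refine (hY.time₂.isPrim_inner hT hY.cont₂ (phiL k)).congr_deriv hT.le ?_
  obtain ⟨ddy₁, ddy₂, -, ⟨dy₂, hd, -, hdd⟩, heq⟩ := hY.space_eq
  filter_upwards [hd.h10, hdd, heq] with t h1 h2 h3
  have e : y₂' t = ddy₂ t + σ t • f₂ - mulBy hq (y₁ t) := by
    refine L2on_eq_of_ae ?_
    filter_upwards [h3, Lp.coeFn_add (ddy₂ t) (σ t • f₂), Lp.coeFn_smul (σ t) f₂,
      Lp.coeFn_sub (ddy₂ t + σ t • f₂) (mulBy hq (y₁ t)), coe_mulBy hq (y₁ t)] with x a1 a2 a3 a4 a5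
    rw [a4, Pi.sub_apply, a2, Pi.add_apply, a3, Pi.smul_apply, smul_eq_mul, a5, ← a1.2]; ring
  rw [e, inner_sub_left, inner_add_left, h1.inner_laplacian h2, real_inner_smul_left,
    inner_mulBy_comm]; ring

/-- `y₁` is the convolution of `σ` with the heat flow of `f₁`. -/
theorem IsStateSol.fst_eq (hY : IsStateSol q σ T f₁ f₂ y₁ y₂ y₁' y₂') (hT : 0 < T)
    (hσ : ContinuousOn σ (Icc 0 T)) (g : L2on Dom) :
    ∀ t ∈ Icc 0 T, inner ℝ (y₁ t) g = conv σ (fun s => inner ℝ (heat f₁ s) g) t := by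
  intro t ht
  have hint : IntegrableOn (fun s => σ (t - s) • heat f₁ s) (Ioc 0 t) := by
    have h1 : IntegrableOn (heat f₁) (Ioc 0 t) := by
      exact (integrableOn_Ioc_iff_integrableOn_Ioo (by simp)).2 ((memLp_heat f₁ t 1).integrable le_rfl)
    have hc : ContinuousOn (fun s => σ (t - s)) (Icc 0 t) :=
      hσ.comp (by fun_prop) fun s hs => ⟨by linarith [hs.2], by linarith [hs.1, ht.2]⟩
    obtain ⟨C, hC⟩ := isCompact_Icc.exists_bound_of_continuousOn hc
    refine Integrable.bdd_smul (C := C) h1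
      ((hc.mono Ioc_subset_Icc_self).aestronglyMeasurable measurableSet_Ioc) ?_
    filter_upwards [ae_restrict_mem measurableSet_Ioc] with s hs
    exact hC s (Ioc_subset_Icc_self hs)
  have hinner : ∀ g : L2on Dom, inner ℝ (∫ s in Ioc 0 t, σ (t - s) • heat f₁ s) g =
      conv σ (fun s => inner ℝ (heat f₁ s) g) t := by
    intro g
    rw [real_inner_comm, ← integral_inner hint, conv, intervalIntegral.integral_of_le ht.1]
    exact integral_congr_ae (Eventually.of_forall fun s => by
      simp only [inner_smul_right, real_inner_comm])
  -- The modes identify `y₁(t)` as a vector of `L²`; this is needed because it will be tested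
  -- against `q φ_k`, which is not an eigenfunction.
  have e : y₁ t = ∫ s in Ioc 0 t, σ (t - s) • heat f₁ s := by
    refine L2on_ext fun j => ?_
    rw [hinner]
    have hw : IsPrim T (fun t => inner ℝ f₁ (phiL (j + 1)) * expDecay (j + 1) t)
        (fun t => -(fun _ => (0 : ℝ)) t -
          ((j + 1 : ℕ) : ℝ) ^ 2 * (inner ℝ f₁ (phiL (j + 1)) * expDecay (j + 1) t)) := by
      have := (isPrim_expDecay (j + 1) T).const_mul (inner ℝ f₁ (phiL (j + 1)))
      refine this.congr_deriv hT.le (Eventually.of_forall fun t => ?_)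
      simp only; ring
    have hz : ∀ t, conv (fun _ => (0 : ℝ)) σ t = 0 := fun t => by simp [conv]
    have := conv_eq_of_ode hT.le hw intervalIntegrable_const hσ
      (by simpa [hz] using hY.isPrim_fst hT (j + 1)) (by simp [hY.init₁]) t ht
    rw [this, conv_comm]
    refine intervalIntegral.integral_congr fun s hs => ?_
    rw [uIcc_of_le ht.1] at hs
    simp only
    rw [inner_heat f₁ hs.1 (Nat.le_add_left 1 j)]
    ring
  rw [e, hinner]

/-- `(W₁, q φ_k)`, where `W₁` is the heat flow of `f₁`. -/
def couplingMode (hq : MemLp q ∞ (volume.restrict Dom)) (f₁ : L2on Dom) (k : ℕ) (t : ℝ) : ℝ :=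
  inner ℝ (heat f₁ t) (mulBy hq (phiL k))

theorem intervalIntegrable_couplingMode (hq : MemLp q ∞ (volume.restrict Dom)) (f₁ : L2on Dom)
    (k : ℕ) {τ : ℝ} (hτ : 0 ≤ τ) : IntervalIntegrable (couplingMode hq f₁ k) volume 0 τ :=
  intervalIntegrable_inner_const hτ (memLp_heat f₁ τ 2) _

/-- The `k`-th mode of the second component of the homogeneous system with datum `(f₁, f₂)`. -/
def sndMode (hq : MemLp q ∞ (volume.restrict Dom)) (f₁ f₂ : L2on Dom) (k : ℕ) (t : ℝ) : ℝ :=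
  inner ℝ f₂ (phiL k) * expDecay k t - conv (expDecay k) (couplingMode hq f₁ k) t

theorem sndMode_zero (hq : MemLp q ∞ (volume.restrict Dom)) (f₁ f₂ : L2on Dom) (k : ℕ) :
    sndMode hq f₁ f₂ k 0 = inner ℝ f₂ (phiL k) := by simp [sndMode]

theorem isPrim_sndMode (hq : MemLp q ∞ (volume.restrict Dom)) (f₁ f₂ : L2on Dom) (k : ℕ) {τ : ℝ}
    (hτ : 0 ≤ τ) : IsPrim τ (sndMode hq f₁ f₂ k)
      (fun t => -couplingMode hq f₁ k t - (k : ℝ) ^ 2 * sndMode hq f₁ f₂ k t) := by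
  have h := ((isPrim_expDecay k τ).const_mul (inner ℝ f₂ (phiL k))).sub
    ((isPrim_expDecay k τ).conv hτ (intervalIntegrable_couplingMode hq f₁ k hτ))
  refine h.congr_deriv hτ (Eventually.of_forall fun t => ?_)
  simp only [sndMode, conv_const_mul_left, expDecay_zero]
  ring

/-- Scalar Duhamel for a single mode: the coupling term `(y₁, q φ_k)` is itself the convolution of
`σ` with `couplingMode`, which is the form of source that `conv_eq_of_ode` accepts. -/
theorem IsStateSol.snd_eq (hY : IsStateSol q σ T f₁ f₂ y₁ y₂ y₁' y₂') (hT : 0 < T)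
    (hσ : ContinuousOn σ (Icc 0 T)) (hq : MemLp q ∞ (volume.restrict Dom)) (k : ℕ) :
    ∀ t ∈ Icc 0 T, inner ℝ (y₂ t) (phiL k) = conv σ (sndMode hq f₁ f₂ k) t := by
  intro t ht
  rw [conv_comm]
  refine conv_eq_of_ode hT.le (isPrim_sndMode hq f₁ f₂ k hT.le)
    (intervalIntegrable_couplingMode hq f₁ k hT.le) hσ
    ((hY.isPrim_snd hT hq k).congr_deriv hT.le ?_) (by simp [hY.init₂]) t ht
  filter_upwards [ae_restrict_mem measurableSet_Ioo] with s hs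
  rw [sndMode_zero, hY.fst_eq hT hσ _ s (Ioo_subset_Icc_self hs), conv_comm σ]
  rfl

theorem IsStateSol.snd_deriv_eq (hY : IsStateSol q σ T f₁ f₂ y₁ y₂ y₁' y₂') (hT : 0 < T)
    {σ' : ℝ → ℝ} (hσ : IsPrim T σ σ') (hq : MemLp q ∞ (volume.restrict Dom)) (k : ℕ) :
    ∀ᵐ t ∂(volume.restrict (Ioo 0 T)), inner ℝ (y₂' t) (phiL k) =
      σ 0 * sndMode hq f₁ f₂ k t + conv σ' (sndMode hq f₁ f₂ k) t := by
  refine (hY.time₂.isPrim_inner hT hY.cont₂ (phiL k)).ae_eq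
    ((hσ.conv hT.le ?_).congr fun t ht => ?_)
  · exact (isPrim_sndMode hq f₁ f₂ k hT.le).continuousOn.intervalIntegrable_of_Icc hT.le
  · exact (hY.snd_eq hT hσ.continuousOn hq k t ht).symm

end State

/-! ### Modes of the adjoint state and of the Volterra equation -/

section Adjoint

variable {q : ℝ → ℝ} {O : Set ℝ} {τ : ℝ} {u : ℝ → L2on O} {z : ℝ → ℝ × ℝ} {p₁ p₂ : ℝ → L2on Dom}

/-- `φ_k` is an admissible test function in the weak formulation, and the gradient term becomes `k²`
times the mode. -/
theorem IsAdjointSol.isPrim_fst (h : IsAdjointSol q O τ u z p₁ p₂) (hτ : 0 < τ)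
    (hq : MemLp q ∞ (volume.restrict Dom)) (hp₂ : MemLp p₂ 2 (volume.restrict (Ioo 0 τ))) (k : ℕ) :
    IsPrim τ (fun t => inner ℝ (p₁ t) (phiL k))
      (fun t => (k : ℝ) ^ 2 * inner ℝ (p₁ t) (phiL k) + inner ℝ (mulBy hq (p₂ t)) (phiL k)) := by
  obtain ⟨dp₁, dp₂, h1, -, hw⟩ := h.weak_eq
  have hφ := (hw _ _ (isH10_phi k)).1
  have hd := memLp_Dom_of_continuous (continuous_dphi k) 2
  have e1 : ∀ t, ∫ x in Dom, dp₁ t x * dphi k x = inner ℝ (dp₁ t) (hd.toLp (dphi k)) :=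
    fun t => (inner_toLp_right _ hd).symm
  have e2 : ∀ t, ∫ x in Dom, q x * p₂ t x * phi k x = inner ℝ (mulBy hq (p₂ t)) (phiL k) := by
    intro t
    rw [inner_phiL]
    refine integral_congr_ae ?_
    filter_upwards [coe_mulBy hq (p₂ t)] with x hx
    rw [hx]
  simp only [← inner_phiL, e2] at hφ
  refine (hφ.isPrim hτ (h.cont₁.inner continuousOn_const) ?_).congr_deriv hτ.le ?_
  · simp only [e1]
    exact (intervalIntegrable_inner_const hτ.le h1.memLp_dx _).add
      (intervalIntegrable_inner_const hτ.le ((mulBy hq).comp_memLp' hp₂) _)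
  · filter_upwards [h1.h10] with t ht
    rw [ht.integral_deriv_mul_dphi, inner_phiL (p₁ t)]

theorem IsAdjointSol.isPrim_snd (h : IsAdjointSol q O τ u z p₁ p₂) (hτ : 0 < τ) (hOsub : O ⊆ Dom)
    (hu : MemLp u 2 (volume.restrict (Ioo 0 τ))) (k : ℕ) :
    IsPrim τ (fun t => inner ℝ (p₂ t) (phiL k))
      (fun t => (k : ℝ) ^ 2 * inner ℝ (p₂ t) (phiL k) - ∫ x in O, u t x * phi k x) := by
  obtain ⟨dp₁, dp₂, -, h2, hw⟩ := h.weak_eq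
  have hφ := (hw _ _ (isH10_phi k)).2
  have hd := memLp_Dom_of_continuous (continuous_dphi k) 2
  have hφO : MemLp (phi k) 2 (volume.restrict O) :=
    (memLp_Dom_of_continuous (continuous_phi k) 2).mono_measure (Measure.restrict_mono hOsub le_rfl)
  have e1 : ∀ t, ∫ x in Dom, dp₂ t x * dphi k x = inner ℝ (dp₂ t) (hd.toLp (dphi k)) :=
    fun t => (inner_toLp_right _ hd).symm
  have e2 : ∀ t, ∫ x in O, u t x * phi k x = inner ℝ (u t) (hφO.toLp (phi k)) :=
    fun t => (inner_toLp_right _ hφO).symm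
  simp only [← inner_phiL] at hφ
  refine (hφ.isPrim hτ (h.cont₂.inner continuousOn_const) ?_).congr_deriv hτ.le ?_
  · simp only [e1, e2]
    exact (intervalIntegrable_inner_const hτ.le h2.memLp_dx _).sub
      (intervalIntegrable_inner_const hτ.le hu _)
  · filter_upwards [h2.h10] with t ht
    rw [ht.integral_deriv_mul_dphi, inner_phiL (p₂ t)]

/-- Pair the equation with `1_O φ_k`. Since `1_O` is independent of time it commutes with the
Volterra operator, and the right side is already supported in `O`. -/
theorem IsVolterraSol.mode {σ σ' : ℝ → ℝ} {θ θ' : ℝ → L2on Dom}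
    (h : IsVolterraSol σ σ' O τ u θ θ') (hO : MeasurableSet O) (hOsub : O ⊆ Dom)
    (hσ : MemLp σ ∞ (volume.restrict (Ioo 0 τ))) (hσ' : MemLp σ' ∞ (volume.restrict (Ioo 0 τ)))
    (k : ℕ) : ∀ᵐ t ∂(volume.restrict (Ioo 0 τ)),
      σ 0 * inner ℝ (mulBy (memLp_indicator_one hO) (θ' t)) (phiL k) +
        ∫ s in t..τ, (σ (s - t) * inner ℝ (mulBy (memLp_indicator_one hO) (θ s)) (phiL k) +
          σ' (s - t) * inner ℝ (mulBy (memLp_indicator_one hO) (θ' s)) (phiL k)) =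
      ∫ x in O, u t x * phi k x := by
  filter_upwards [h.eqn, ae_restrict_mem measurableSet_Ioo] with t ht htτ
  set g := mulBy (memLp_indicator_one hO) (phiL k) with hg
  simp only [inner_mulBy_comm, ← hg]
  set V := σ 0 • θ' t + ∫ s in t..τ, (σ (s - t) • θ s + σ' (s - t) • θ' s) with hV
  have e1 : inner ℝ V g = ∫ x in O, u t x * phi k x := by
    rw [hg, ← inner_mulBy_comm, inner_mulBy, ← integral_mulBy_indicator hO hOsub]
    refine integral_congr_ae ?_
    filter_upwards [ht, coe_phiL k] with x hx hφ
    rw [hx, hφ]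
    by_cases hxO : x ∈ O <;> simp [hxO]
  rw [← e1, hV, inner_add_left, real_inner_smul_left]
  congr 1
  have i1 := intervalIntegrable_shift_mul hσ (h.time.memLp.integrable (by norm_num)) htτ
  have i2 := intervalIntegrable_shift_mul hσ' (h.time.memLp_deriv.integrable (by norm_num)) htτ
  have i3 := (i1.add i2).1
  rw [real_inner_comm, intervalIntegral.integral_of_le htτ.2.le,
    intervalIntegral.integral_of_le htτ.2.le, ← integral_inner i3]
  refine integral_congr_ae (Eventually.of_forall fun s => ?_)
  simp only [inner_add_right, inner_smul_right, real_inner_comm g]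

end Adjoint


/-! ### Duality between the state and the controlled adjoint state -/

theorem inner_phiL_phiL {i j : ℕ} (hi : 1 ≤ i) :
    inner ℝ (phiL i) (phiL j) = if i = j then 1 else 0 := by
  rw [inner_phiL, ← integral_phi_mul_phi hi]
  refine integral_congr_ae ?_
  filter_upwards [coe_phiL i] with x hx
  rw [hx]

theorem setIntegral_Ioo_eq {τ : ℝ} (hτ : 0 ≤ τ) (f : ℝ → ℝ) :
    ∫ t in Ioo 0 τ, f t = ∫ t in (0 : ℝ)..τ, f t := by
  rw [intervalIntegral.integral_of_le hτ, integral_Ioc_eq_integral_Ioo]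

theorem setIntegral_mul_eq_inner {O : Set ℝ} (hO : MeasurableSet O) (hsub : O ⊆ Dom)
    (f g : L2on Dom) :
    ∫ x in O, f x * g x = inner ℝ f (mulBy (memLp_indicator_one hO) g) := by
  rw [← inner_mulBy_comm, inner_mulBy, integral_mulBy_indicator hO hsub]

theorem innerH1_zeroExt {O : Set ℝ} (hO : MeasurableSet O) (hsub : O ⊆ Dom) {τ T : ℝ}
    (hτT : τ ≤ T) (v v' w w' : ℝ → L2on Dom) :
    innerH1 T O v v' (zeroExt τ w) (zeroExt τ w') =
      ∫ t in Ioo 0 τ, (inner ℝ (v t) (mulBy (memLp_indicator_one hO) (w t)) +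
        inner ℝ (v' t) (mulBy (memLp_indicator_one hO) (w' t))) := by
  rw [innerH1]
  simp only [setIntegral_mul_eq_inner hO hsub]
  have e : ∀ t, inner ℝ (v t) (mulBy (memLp_indicator_one hO) (zeroExt τ w t)) +
        inner ℝ (v' t) (mulBy (memLp_indicator_one hO) (zeroExt τ w' t)) =
      (Ioo 0 τ).indicator (fun t => inner ℝ (v t) (mulBy (memLp_indicator_one hO) (w t)) +
        inner ℝ (v' t) (mulBy (memLp_indicator_one hO) (w' t))) t := by
    intro t
    by_cases ht : t ∈ Ioo 0 τ <;> simp [zeroExt, ht]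
  simp only [e]
  rw [integral_indicator measurableSet_Ioo, Measure.restrict_restrict measurableSet_Ioo,
    inter_eq_left.2 (Ioo_subset_Ioo_right hτT)]

theorem memLp_two_of_continuousOn {v : ℝ → L2on Dom} {τ : ℝ} (hv : ContinuousOn v (Icc 0 τ)) :
    MemLp v 2 (volume.restrict (Ioo 0 τ)) := by
  obtain ⟨C, hC⟩ := isCompact_Icc.exists_bound_of_continuousOn hv
  refine MemLp.of_bound ((hv.mono Ioo_subset_Icc_self).aestronglyMeasurable measurableSet_Ioo) C ?_
  filter_upwards [ae_restrict_mem measurableSet_Ioo] with x hx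
  exact hC x (Ioo_subset_Icc_self hx)

theorem memLp_top_of_continuousOn {v : ℝ → ℝ} {τ : ℝ} (hv : ContinuousOn v (Icc 0 τ)) :
    MemLp v ∞ (volume.restrict (Ioo 0 τ)) := by
  obtain ⟨C, hC⟩ := isCompact_Icc.exists_bound_of_continuousOn hv
  refine MemLp.of_bound ((hv.mono Ioo_subset_Icc_self).aestronglyMeasurable measurableSet_Ioo) C ?_
  filter_upwards [ae_restrict_mem measurableSet_Ioo] with x hx
  exact hC x (Ioo_subset_Icc_self hx)

section Duality

variable {q σ σ' : ℝ → ℝ} {T τ : ℝ} {O : Set ℝ} {f₁ f₂ : L2on Dom} {y₁ y₂ y₁' y₂' : ℝ → L2on Dom}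
  {u : ℝ → L2on O} {z : ℝ → ℝ × ℝ} {p₁ p₂ θ θ' : ℝ → L2on Dom}

/-- The `k`-th mode of the `H¹(0,τ; L²(O))` inner product of `y₂` and `θ`. -/
theorem integral_mode_mul_volterra (hY : IsStateSol q σ T f₁ f₂ y₁ y₂ y₁' y₂') (hT : 0 < T)
    (hτ : τ ∈ Ioc 0 T) (hσ : IsPrim T σ σ') (hσ' : MemLp σ' ∞ (volume.restrict (Ioo 0 T)))
    (hq : MemLp q ∞ (volume.restrict Dom)) (hO : MeasurableSet O) (hOsub : O ⊆ Dom)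
    (hu : MemLp u 2 (volume.restrict (Ioo 0 τ))) (hp : IsAdjointSol q O τ u z p₁ p₂)
    (hp0 : p₂ 0 = 0) (hθ : IsVolterraSol σ σ' O τ u θ θ') (k : ℕ) :
    (∫ t in Ioo 0 τ, inner ℝ (y₂ t) (phiL k) *
        inner ℝ (mulBy (memLp_indicator_one hO) (θ t)) (phiL k)) +
      ∫ t in Ioo 0 τ, inner ℝ (y₂' t) (phiL k) *
        inner ℝ (mulBy (memLp_indicator_one hO) (θ' t)) (phiL k) =
    -(sndMode hq f₁ f₂ k τ * inner ℝ (p₂ τ) (phiL k)) -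
      ∫ t in Ioo 0 τ, inner ℝ (mulBy hq (heat f₁ t)) (phiL k) * inner ℝ (p₂ t) (phiL k) := by
  have hτ0 := hτ.1.le
  have hsub : Ioo 0 τ ⊆ Ioo 0 T := Ioo_subset_Ioo_right hτ.2
  have hle : (volume : Measure ℝ).restrict (Ioo 0 τ) ≤ volume.restrict (Ioo 0 T) :=
    Measure.restrict_mono hsub le_rfl
  set w := sndMode hq f₁ f₂ k with hw
  set ϑ : ℝ → ℝ := fun t => inner ℝ (mulBy (memLp_indicator_one hO) (θ t)) (phiL k) with hϑ
  set ϑ' : ℝ → ℝ := fun t => inner ℝ (mulBy (memLp_indicator_one hO) (θ' t)) (phiL k) with hϑ'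
  have mθ : MemLp (fun t => mulBy (memLp_indicator_one hO) (θ t)) 2 (volume.restrict (Ioo 0 τ)) :=
    (mulBy _).comp_memLp' hθ.time.memLp
  have mθ' : MemLp (fun t => mulBy (memLp_indicator_one hO) (θ' t)) 2 (volume.restrict (Ioo 0 τ)) :=
    (mulBy _).comp_memLp' hθ.time.memLp_deriv
  have m1 : IntegrableOn (fun t => inner ℝ (y₂ t) (phiL k) * ϑ t) (Ioo 0 τ) :=
    MemLp.integrable_mul_two ((hY.time₂.memLp.mono_measure hle).inner_const _) (mθ.inner_const _)
  have m2 : IntegrableOn (fun t => inner ℝ (y₂' t) (phiL k) * ϑ' t) (Ioo 0 τ) :=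
    MemLp.integrable_mul_two ((hY.time₂.memLp_deriv.mono_measure hle).inner_const _)
      (mθ'.inner_const _)
  have hpw := isPrim_sndMode hq f₁ f₂ k hτ0
  have hpp := hp.isPrim_snd hτ.1 hOsub hu k
  -- This moves the convolution with `σ` from the homogeneous mode `w` to `θ`, where the Volterra
  -- equation replaces it by the control.
  have hvol := integral_volterra_duality hτ0
    ((memLp_top_of_continuousOn hσ.continuousOn).mono_measure hle)
    (hσ'.mono_measure hle) hpw.continuousOn (intervalIntegrable_inner_const hτ0 mθ (phiL k))
    (intervalIntegrable_inner_const hτ0 mθ' (phiL k))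
  rw [← integral_add m1 m2]
  have e1 : ∫ t in Ioo 0 τ, (inner ℝ (y₂ t) (phiL k) * ϑ t + inner ℝ (y₂' t) (phiL k) * ϑ' t) =
      ∫ t in (0 : ℝ)..τ, (conv σ w t * ϑ t + (σ 0 * w t + conv σ' w t) * ϑ' t) := by
    rw [← setIntegral_Ioo_eq hτ0]
    refine integral_congr_ae ?_
    filter_upwards [ae_mono hle (hY.snd_deriv_eq hT hσ hq k), ae_restrict_mem measurableSet_Ioo]
      with t h1 h2
    rw [h1, hY.snd_eq hT hσ.continuousOn hq k t (Ioo_subset_Icc_self (hsub h2))]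
  rw [e1, hvol]
  have e2 : ∫ t in (0 : ℝ)..τ, w t * (σ 0 * ϑ' t + ∫ s in t..τ,
        (σ (s - t) * ϑ s + σ' (s - t) * ϑ' s)) =
      ∫ t in (0 : ℝ)..τ, w t * ∫ x in O, u t x * phi k x := by
    rw [← setIntegral_Ioo_eq hτ0, ← setIntegral_Ioo_eq hτ0]
    refine integral_congr_ae ?_
    filter_upwards [hθ.mode hO hOsub ((memLp_top_of_continuousOn hσ.continuousOn).mono_measure hle)
      (hσ'.mono_measure hle) k] with t ht
    rw [ht]
  rw [e2]
  -- Forward and backward modes have opposite rates, so the `k²` terms cancel; the boundary term at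
  -- `0` vanishes by null controllability.
  have h3 := hpw.integral_mul hτ0 hpp
  rw [hp0, inner_zero_left, mul_zero, sub_zero] at h3
  have e3 : ∀ t, (-couplingMode hq f₁ k t - (k : ℝ) ^ 2 * w t) * inner ℝ (p₂ t) (phiL k) +
      w t * ((k : ℝ) ^ 2 * inner ℝ (p₂ t) (phiL k) - ∫ x in O, u t x * phi k x) =
      -(couplingMode hq f₁ k t * inner ℝ (p₂ t) (phiL k)) -
        w t * ∫ x in O, u t x * phi k x := fun t => by ring
  simp only [← hw, e3] at h3
  have i1 : IntervalIntegrable (fun t => couplingMode hq f₁ k t * inner ℝ (p₂ t) (phiL k))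
      volume 0 τ :=
    intervalIntegrable_mul_continuousOn hτ0 (intervalIntegrable_couplingMode hq f₁ k hτ0)
      hpp.continuousOn
  have iu : IntervalIntegrable (fun t => ∫ x in O, u t x * phi k x) volume 0 τ := by
    have h5 : IntervalIntegrable (fun t => (k : ℝ) ^ 2 * inner ℝ (p₂ t) (phiL k)) volume 0 τ :=
      (hpp.continuousOn.intervalIntegrable_of_Icc hτ0).const_mul _
    have := h5.sub hpp.int
    simpa using this
  have i2 : IntervalIntegrable (fun t => w t * ∫ x in O, u t x * phi k x) volume 0 τ := by
    have := intervalIntegrable_mul_continuousOn hτ0 iu hpw.continuousOn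
    simpa only [mul_comm] using this
  rw [intervalIntegral.integral_sub
    (show IntervalIntegrable (fun t => -(couplingMode hq f₁ k t * inner ℝ (p₂ t) (phiL k)))
      volume 0 τ from i1.neg) i2, intervalIntegral.integral_neg] at h3
  simp only [inner_mulBy_comm]
  rw [setIntegral_Ioo_eq hτ0]
  simp only [couplingMode] at h3
  linarith

/-- Formally `d/dt (W₁, p₁) = (W₁, q p₂)`, as the Laplacians cancel, and `p₁(0) = 0`. This is
verified on each mode and summed by Parseval. -/
theorem integral_inner_heat_mulBy (hτ : 0 < τ) (hq : MemLp q ∞ (volume.restrict Dom))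
    (hp : IsAdjointSol q O τ u z p₁ p₂) (hp0 : p₁ 0 = 0) (f₁ : L2on Dom) :
    ∫ t in Ioo 0 τ, inner ℝ (mulBy hq (heat f₁ t)) (p₂ t) = inner ℝ (heat f₁ τ) (p₁ τ) := by
  have hp₂ : MemLp p₂ 2 (volume.restrict (Ioo 0 τ)) := memLp_two_of_continuousOn hp.cont₂
  simp only [inner_mulBy_comm]
  refine (hasSum_integral_inner_phiL (memLp_heat f₁ τ 2) ((mulBy hq).comp_memLp' hp₂)).unique ?_
  refine (hasSum_inner_phiL (heat f₁ τ) (p₁ τ)).congr_fun fun j => ?_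
  have h := ((isPrim_expDecay (j + 1) τ).const_mul (inner ℝ f₁ (phiL (j + 1)))).integral_mul hτ.le
    (hp.isPrim_fst hτ hq hp₂ (j + 1))
  rw [hp0, inner_zero_left, mul_zero, sub_zero] at h
  rw [inner_heat f₁ hτ.le (Nat.le_add_left 1 j), mul_comm (expDecay _ _), ← h,
    setIntegral_Ioo_eq hτ.le]
  refine intervalIntegral.integral_congr fun t ht => ?_
  rw [uIcc_of_le hτ.le] at ht
  simp only [Function.comp]
  rw [inner_heat f₁ ht.1 (Nat.le_add_left 1 j)]
  ring

/-- Sum the modal identities. As `p₂(τ) = φ_k`, only one mode of `W₂(τ)` survives, which is why `W₂`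
never has to be built as a function; the coupling terms add up to `(W₁(τ), p₁(τ))`. -/
theorem innerH1_eq_pairing (hY : IsStateSol q σ T f₁ f₂ y₁ y₂ y₁' y₂') (hT : 0 < T)
    (hτ : τ ∈ Ioc 0 T) (hσ : IsPrim T σ σ') (hσ' : MemLp σ' ∞ (volume.restrict (Ioo 0 T)))
    (hq : MemLp q ∞ (volume.restrict Dom)) (hO : MeasurableSet O) (hOsub : O ⊆ Dom)
    (hu : MemLp u 2 (volume.restrict (Ioo 0 τ))) (hp : IsAdjointSol q O τ u z p₁ p₂)
    (hp₁0 : p₁ 0 = 0) (hp₂0 : p₂ 0 = 0) (hθ : IsVolterraSol σ σ' O τ u θ θ') {k : ℕ} (hk : 1 ≤ k)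
    (hp₂τ : p₂ τ = phiL k) :
    innerH1 T O y₂ y₂' (zeroExt τ θ) (zeroExt τ θ') =
      -(sndMode hq f₁ f₂ k τ + inner ℝ (heat f₁ τ) (p₁ τ)) := by
  have hle : (volume : Measure ℝ).restrict (Ioo 0 τ) ≤ volume.restrict (Ioo 0 T) :=
    Measure.restrict_mono (Ioo_subset_Ioo_right hτ.2) le_rfl
  have mθ : MemLp (fun t => mulBy (memLp_indicator_one hO) (θ t)) 2 (volume.restrict (Ioo 0 τ)) :=
    (mulBy _).comp_memLp' hθ.time.memLp
  have mθ' : MemLp (fun t => mulBy (memLp_indicator_one hO) (θ' t)) 2 (volume.restrict (Ioo 0 τ)) :=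
    (mulBy _).comp_memLp' hθ.time.memLp_deriv
  have my := hY.time₂.memLp.mono_measure hle
  have my' := hY.time₂.memLp_deriv.mono_measure hle
  rw [innerH1_zeroExt hO hOsub hτ.2, integral_add (integrable_inner my mθ)
    (integrable_inner my' mθ')]
  have hs := (hasSum_integral_inner_phiL my mθ).add (hasSum_integral_inner_phiL my' mθ')
  simp only [integral_mode_mul_volterra hY hT hτ hσ hσ' hq hO hOsub hu hp hp₂0 hθ] at hs
  have hs1 : HasSum (fun j : ℕ => -(sndMode hq f₁ f₂ (j + 1) τ * inner ℝ (p₂ τ) (phiL (j + 1))))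
      (-sndMode hq f₁ f₂ k τ) := by
    obtain ⟨m, rfl⟩ := Nat.exists_eq_add_of_le' hk
    have := hasSum_single (f := fun j : ℕ =>
      -(sndMode hq f₁ f₂ (j + 1) τ * inner ℝ (p₂ τ) (phiL (j + 1)))) m (fun j hj => by
        rw [hp₂τ, inner_phiL_phiL hk, if_neg (by omega), mul_zero, neg_zero])
    simp only [hp₂τ] at this ⊢
    rwa [inner_phiL_phiL hk, if_pos rfl, mul_one] at this
  have hs2 := hasSum_integral_inner_phiL ((mulBy hq).comp_memLp' (memLp_heat f₁ τ 2))
    (memLp_two_of_continuousOn hp.cont₂)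
  have := hs.unique (hs1.sub hs2)
  rw [this]
  simp only [Function.comp]
  rw [integral_inner_heat_mulBy hτ.1 hq hp hp₁0]
  ring

end Duality

/-! ### Evolution of the pairing with the generalized eigenfunctions -/

/-- The modes of a solution of the homogeneous system along `(ψ_k, φ_k)`. -/
theorem inner_heat_psi {q : ℝ → ℝ} (hq : MemLp q ∞ (volume.restrict Dom)) {k : ℕ} (hk : 1 ≤ k)
    {ψ : L2on Dom} (hψ : ∀ᵐ x ∂(volume.restrict Dom), ψ x = psi q k x) (f : L2on Dom) {τ : ℝ}
    (hτ : 0 ≤ τ) :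
    inner ℝ (heat f τ) ψ = expDecay k τ * (inner ℝ f ψ - Ik q k * τ * inner ℝ f (phiL k)) +
      conv (expDecay k) (couplingMode hq f k) τ := by
  set g : L2on Dom := mulBy hq (phiL k) - Ik q k • phiL k with hg
  -- In modes, `g = q φ_k - I_k(q) φ_k = ψ_k'' + k² ψ_k`.
  have hmode : ∀ i, 1 ≤ i →
      inner ℝ g (phiL i) = ((k : ℝ) ^ 2 - (i : ℝ) ^ 2) * inner ℝ ψ (phiL i) := by
    intro i hi
    have h1 := integral_psi_mul_phi hq hk i
    have h2 : ∫ x in Dom, psi q k x * phi i x = inner ℝ ψ (phiL i) := by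
      rw [inner_phiL]
      refine integral_congr_ae ?_
      filter_upwards [hψ] with x hx
      rw [hx]
    have h3 : ∫ x in Dom, q x * phi k x * phi i x = inner ℝ (mulBy hq (phiL k)) (phiL i) := by
      rw [inner_mulBy]
      refine integral_congr_ae ?_
      filter_upwards [coe_phiL k, coe_phiL i] with x hx hx'
      rw [hx, hx']
    rw [h2, h3] at h1
    rw [hg, inner_sub_left, real_inner_smul_left, inner_phiL_phiL hk]
    split_ifs at h1 ⊢ <;> linarith
  have hw : MemLp (fun s => expDecay k (τ - s) • g) 2 (volume.restrict (Ioo 0 τ)) :=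
    memLp_two_of_continuousOn ((((continuous_expDecay k).comp
      (continuous_const.sub continuous_id)).smul continuous_const).continuousOn)
  have hs := hasSum_integral_inner_phiL (memLp_heat f τ 2) hw
  have hterm : ∀ j : ℕ, (∫ s in Ioo 0 τ, inner ℝ (heat f s) (phiL (j + 1)) *
      inner ℝ (expDecay k (τ - s) • g) (phiL (j + 1))) =
      inner ℝ (heat f τ) (phiL (j + 1)) * inner ℝ ψ (phiL (j + 1)) -
        expDecay k τ * (inner ℝ f (phiL (j + 1)) * inner ℝ ψ (phiL (j + 1))) := by
    intro j
    -- With `i = j + 1`, the `s`-derivative of `e^{-i²s} e^{-k²(τ-s)}` is `k² - i²` times itself,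
    -- the factor in `hmode`; so no division is needed, even at `i = k`.
    have hr : IsPrim τ (fun s => expDecay k (τ - s)) (fun s => (k : ℝ) ^ 2 * expDecay k (τ - s)) := by
      refine IsPrim.of_hasDerivAt (fun s => ?_)
        (continuous_const.mul ((continuous_expDecay k).comp (continuous_const.sub continuous_id)))
      refine ((hasDerivAt_expDecay k (τ - s)).comp s ((hasDerivAt_id s).const_sub τ)).congr_deriv ?_
      ring
    have h := (isPrim_expDecay (j + 1) τ).integral_mul hτ hr
    rw [sub_self, sub_zero, expDecay_zero, expDecay_zero, mul_one, one_mul] at h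
    rw [inner_heat f hτ (Nat.le_add_left 1 j), setIntegral_Ioo_eq hτ]
    have e : (expDecay (j + 1) τ - expDecay k τ) *
        (inner ℝ f (phiL (j + 1)) * inner ℝ ψ (phiL (j + 1))) =
        expDecay (j + 1) τ * inner ℝ f (phiL (j + 1)) * inner ℝ ψ (phiL (j + 1)) -
        expDecay k τ * (inner ℝ f (phiL (j + 1)) * inner ℝ ψ (phiL (j + 1))) := by ring
    rw [← e, ← h, ← intervalIntegral.integral_mul_const]
    refine intervalIntegral.integral_congr fun s hs => ?_
    rw [uIcc_of_le hτ] at hs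
    rw [inner_heat f hs.1 (Nat.le_add_left 1 j), real_inner_smul_left,
      hmode _ (Nat.le_add_left 1 j)]
    ring
  simp only [hterm] at hs
  have hu := hs.unique ((hasSum_inner_phiL (heat f τ) ψ).sub
    ((hasSum_inner_phiL f ψ).mul_left (expDecay k τ)))
  -- Against `φ_k` the exponentials combine to the constant `e^{-k²τ}`: the resonance that produces
  -- the factor `τ`.
  have hconv : ∫ s in Ioo 0 τ, inner ℝ (heat f s) (expDecay k (τ - s) • g) =
      conv (expDecay k) (couplingMode hq f k) τ -
        τ * (Ik q k * inner ℝ f (phiL k) * expDecay k τ) := by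
    have ic : IntervalIntegrable (fun s => expDecay k (τ - s) * couplingMode hq f k s) volume 0 τ := by
      have := intervalIntegrable_mul_continuousOn (g := fun s => expDecay k (τ - s)) hτ
        (intervalIntegrable_couplingMode hq f k hτ)
        ((continuous_expDecay k).comp (continuous_const.sub continuous_id)).continuousOn
      exact this.congr fun s _ => mul_comm _ _
    have e : ∫ s in (0 : ℝ)..τ, inner ℝ (heat f s) (expDecay k (τ - s) • g) =
        ∫ s in (0 : ℝ)..τ, (expDecay k (τ - s) * couplingMode hq f k s -
          Ik q k * inner ℝ f (phiL k) * expDecay k τ) := by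
      refine intervalIntegral.integral_congr fun s hs => ?_
      rw [uIcc_of_le hτ] at hs
      simp only [couplingMode]
      rw [hg, real_inner_smul_right, inner_sub_right, real_inner_smul_right, inner_heat f hs.1 hk]
      have : expDecay k τ = expDecay k (τ - s) * expDecay k s := by
        rw [expDecay, expDecay, expDecay, ← Real.exp_add]; congr 1; ring
      rw [this]; ring
    rw [setIntegral_Ioo_eq hτ, e, intervalIntegral.integral_sub ic intervalIntegrable_const,
      intervalIntegral.integral_const]
    simp [conv]
  rw [hconv] at hu
  linarith

/-- The pairing of the homogeneous solution with `Φ*_{1,k} + Φ*_{2,k}` at time `t`, as a function of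
the pairing `c` at time `0` and of `d = (f₁, φ_k)`. -/
def pairing (q : ℝ → ℝ) (k : ℕ) (c d t : ℝ) : ℝ := expDecay k t * (c - Ik q k * t * d)

theorem hasDerivAt_pairing (q : ℝ → ℝ) (k : ℕ) (c d t : ℝ) :
    HasDerivAt (pairing q k c d)
      (-(k : ℝ) ^ 2 * (expDecay k t * (c - Ik q k * t * d)) - expDecay k t * (Ik q k * d)) t := by
  have h := (hasDerivAt_expDecay k t).mul
    ((((hasDerivAt_id t).const_mul (Ik q k)).mul_const d).const_sub c)
  refine h.congr_deriv ?_
  simp only [id, mul_one]; ring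

theorem continuous_pairing (q : ℝ → ℝ) (k : ℕ) (c d : ℝ) : Continuous (pairing q k c d) :=
  continuous_iff_continuousAt.2 fun t => (hasDerivAt_pairing q k c d t).continuousAt

/-- Integration by parts in the reconstruction formula. -/
theorem pairing_formula {q σ σ' : ℝ → ℝ} {T : ℝ} (hT : 0 < T) (hσ : IsPrim T σ σ') (hσT : σ T ≠ 0)
    (k : ℕ) (c d : ℝ) :
    aL σ k T * c + bL q σ k T * d =
      σ 0 * pairing q k c d T + ∫ s in (0 : ℝ)..T, σ' (T - s) * pairing q k c d s := by
  -- With `P` the pairing, integrate `σ` by parts against `s ↦ P(T - s)`; the boundary value at `s =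
  -- T` is `σ(T) P(0) = σ(T) c`.
  have hr : IsPrim T (fun s => pairing q k c d (T - s)) (fun s =>
      -(-(k : ℝ) ^ 2 * (expDecay k (T - s) * (c - Ik q k * (T - s) * d)) -
        expDecay k (T - s) * (Ik q k * d))) := by
    refine IsPrim.of_hasDerivAt (fun s => ?_) ?_
    · refine ((hasDerivAt_pairing q k c d (T - s)).comp s
        ((hasDerivAt_id s).const_sub T)).congr_deriv ?_
      ring
    · unfold expDecay; fun_prop
  have h := hσ.integral_mul hT.le hr
  rw [sub_self, sub_zero] at h
  have hσi : IntervalIntegrable σ volume 0 T := hσ.continuousOn.intervalIntegrable_of_Icc hT.le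
  have iA : IntervalIntegrable (fun s => Real.exp (-(k : ℝ) ^ 2 * (T - s)) * σ s) volume 0 T :=
    hσi.continuousOn_mul (Continuous.continuousOn (by fun_prop))
  have iB : IntervalIntegrable (fun s => (T - s) * Real.exp (-(k : ℝ) ^ 2 * (T - s)) * σ s)
      volume 0 T := hσi.continuousOn_mul (Continuous.continuousOn (by fun_prop))
  have i1 : IntervalIntegrable (fun s => σ' s * pairing q k c d (T - s)) volume 0 T :=
    hσ.int.mul_continuousOn (((continuous_pairing q k c d).comp
      (continuous_const.sub continuous_id)).continuousOn)
  have e : ∀ s, σ' s * pairing q k c d (T - s) + σ s *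
      -(-(k : ℝ) ^ 2 * (expDecay k (T - s) * (c - Ik q k * (T - s) * d)) -
        expDecay k (T - s) * (Ik q k * d)) =
      σ' s * pairing q k c d (T - s) +
        ((((k : ℝ) ^ 2 * c + Ik q k * d) * (Real.exp (-(k : ℝ) ^ 2 * (T - s)) * σ s)) -
        ((k : ℝ) ^ 2 * Ik q k * d) * ((T - s) * Real.exp (-(k : ℝ) ^ 2 * (T - s)) * σ s)) :=
    fun s => by unfold expDecay; ring
  simp only [e] at h
  rw [intervalIntegral.integral_add i1 ((iA.const_mul _).sub (iB.const_mul _)),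
    intervalIntegral.integral_sub (iA.const_mul _) (iB.const_mul _),
    intervalIntegral.integral_const_mul, intervalIntegral.integral_const_mul] at h
  have hc : ∫ s in (0 : ℝ)..T, σ' (T - s) * pairing q k c d s =
      ∫ s in (0 : ℝ)..T, σ' s * pairing q k c d (T - s) := by
    have := conv_comm σ' (pairing q k c d) T
    rw [conv, conv] at this
    rw [this]
    exact intervalIntegral.integral_congr fun s _ => mul_comm _ _
  have h0 : pairing q k c d 0 = c := by simp [pairing]
  rw [h0] at h
  rw [hc, aL, bL, mul_sub, mul_one, ← mul_assoc (σ T), mul_div_cancel₀ _ hσT]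
  linarith

end SourceRec

end


open SourceRec in
theorem mainTheorem2
    (T : ℝ) (hT : 0 < T)
    (O O' : Set ℝ) (hO : IsOpen O) (hOsub : O ⊆ SourceRec.Dom)
    (hO' : IsOpen O') (hO'ne : O'.Nonempty) (hO'sub : O' ⊆ O)
    (q dq : ℝ → ℝ)
    (hq : MemLp q ∞ (volume.restrict SourceRec.Dom))
    (hq' : SourceRec.IsW1p O' ∞ q dq)
    (hqpos : ∃ C : ℝ, 0 < C ∧ ∀ᵐ x ∂(volume.restrict SourceRec.Dom), C ≤ q x)
    -- the continuous representative `σ` of a function in `W^{1,∞}(0,T)`, with derivative `σ'`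
    (σ σ' : ℝ → ℝ) (hσc : ContinuousOn σ (Icc 0 T))
    (hσ : SourceRec.IsW1p (Ioo 0 T) ∞ σ σ') (hσT : σ T ≠ 0)
    (k : ℕ) (hk : 1 ≤ k) (ha : SourceRec.aL σ k T ≠ 0)
    -- for every `τ ∈ (0,T]`, a null control `u τ` and the associated Volterra solution `θ τ`
    (u : ℝ → ℝ → SourceRec.L2on O)
    (hu : ∀ τ ∈ Ioc 0 T, SourceRec.IsNullControl q O τ
      (fun x => SourceRec.PhiStar1 q k x + SourceRec.PhiStar2 k x) (u τ))
    (θ θ' : ℝ → ℝ → SourceRec.L2on SourceRec.Dom)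
    (hθ : ∀ τ ∈ Ioc 0 T, SourceRec.IsVolterraSol σ σ' O τ (u τ) (θ τ) (θ' τ))
    (f₁ f₂ : SourceRec.L2on SourceRec.Dom)
    (y₁ y₂ y₁' y₂' : ℝ → SourceRec.L2on SourceRec.Dom)
    (hY : SourceRec.IsStateSol q σ T f₁ f₂ y₁ y₂ y₁' y₂') :
    IntervalIntegrable (fun s => σ' (T - s) *
        SourceRec.innerH1 T O y₂ y₂'
          (SourceRec.zeroExt s (θ s)) (SourceRec.zeroExt s (θ' s))) volume 0 T ∧
    SourceRec.aL σ k T *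
        ((∫ x in SourceRec.Dom, f₁ x * SourceRec.phi k x) +
          (∫ x in SourceRec.Dom, f₁ x * SourceRec.psi q k x) +
          ∫ x in SourceRec.Dom, f₂ x * SourceRec.phi k x) +
      SourceRec.bL q σ k T * (∫ x in SourceRec.Dom, f₁ x * SourceRec.phi k x)
    = - σ 0 * SourceRec.innerH1 T O y₂ y₂'
          (SourceRec.zeroExt T (θ T)) (SourceRec.zeroExt T (θ' T)) -
      ∫ s in (0 : ℝ)..T, σ' (T - s) *
        SourceRec.innerH1 T O y₂ y₂'
          (SourceRec.zeroExt s (θ s)) (SourceRec.zeroExt s (θ' s)) := by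
  have hσi : IntervalIntegrable σ' volume 0 T :=
    (intervalIntegrable_iff_integrableOn_Ioo_of_le hT.le).2
      (hσ.memLp_deriv.integrable (by simp))
  have hσp : IsPrim T σ σ' := hσ.weakDeriv.isPrim hT hσc hσi
  have hψm := memLp_Dom_of_continuousOn (continuousOn_psi hq k) 2
  set ψ : L2on Dom := hψm.toLp (psi q k) with hψ
  have hψae : ∀ᵐ x ∂(volume.restrict Dom), ψ x = psi q k x := hψm.coeFn_toLp
  rw [← inner_phiL, ← inner_phiL, ← inner_toLp_right f₁ hψm, ← hψ]
  set c := inner ℝ f₁ (phiL k) + inner ℝ f₁ ψ + inner ℝ f₂ (phiL k) with hc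
  set d := inner ℝ f₁ (phiL k) with hd
  have key : ∀ τ ∈ Ioc 0 T, innerH1 T O y₂ y₂' (zeroExt τ (θ τ)) (zeroExt τ (θ' τ)) =
      -pairing q k c d τ := by
    intro τ hτ
    obtain ⟨hum, p₁, p₂, hp, hp₁0, hp₂0⟩ := hu τ hτ
    have hp₂τ : p₂ τ = phiL k := by
      refine L2on_eq_of_ae ?_
      filter_upwards [hp.final₂, coe_phiL k] with x h1 h2
      rw [h1, h2]; simp [PhiStar1, PhiStar2]
    have hp₁τ : p₁ τ = ψ + phiL k := by
      refine L2on_eq_of_ae ?_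
      filter_upwards [hp.final₁, coe_phiL k, hψae, Lp.coeFn_add ψ (phiL k)] with x h1 h2 h3 h4
      rw [h1, h4, Pi.add_apply, h2, h3]; rfl
    -- The convolution of `expDecay` with `couplingMode` enters with opposite signs from `sndMode`
    -- and `inner_heat_psi`, and cancels.
    rw [innerH1_eq_pairing hY hT hτ hσp hσ.memLp_deriv hq hO.measurableSet hOsub hum hp hp₁0 hp₂0
      (hθ τ hτ) hk hp₂τ, hp₁τ, inner_add_right, inner_heat_psi hq hk hψae f₁ hτ.1.le,
      inner_heat f₁ hτ.1.le hk, sndMode, pairing, hc, hd]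
    ring
  -- The identity holds for every `s ∈ (0,T]`, so the integrand is explicit and integrable although
  -- nothing is assumed on how `θ s` depends on `s`.
  have hcongr : ∀ s ∈ uIoc 0 T, σ' (T - s) * -pairing q k c d s =
      σ' (T - s) * innerH1 T O y₂ y₂' (zeroExt s (θ s)) (zeroExt s (θ' s)) := by
    intro s hs
    rw [uIoc_of_le hT.le] at hs
    rw [key s hs]
  have hint : IntervalIntegrable (fun s => σ' (T - s) * -pairing q k c d s) volume 0 T :=
    intervalIntegrable_conv_integrand hT.le hσi (continuous_pairing q k c d).neg.continuousOn
  refine ⟨hint.congr hcongr, ?_⟩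
  rw [pairing_formula hT hσp hσT, key T ⟨hT, le_rfl⟩]
  have : ∫ s in (0 : ℝ)..T, σ' (T - s) *
      innerH1 T O y₂ y₂' (zeroExt s (θ s)) (zeroExt s (θ' s)) =
      ∫ s in (0 : ℝ)..T, -(σ' (T - s) * pairing q k c d s) := by
    refine intervalIntegral.integral_congr_ae (Filter.Eventually.of_forall fun s hs => ?_)
    rw [← hcongr s hs, mul_neg]
  rw [this, intervalIntegral.integral_neg]
  ring
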